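/- Let $\gamma_0,\gamma_1>0$. There is a constant $C>0$, depending only on $\gamma_0$ and $\gamma_1$, such that the following holds. Let $K\subset\mathbb R^2$ be a polygon of diameter $h_K$ that is star-shaped with respect to a ball of radius $\ge\gamma_0 h_K$ and such that the distance between any two distinct vertices of $K$ is $\ge\gamma_1 h_K$. Let $\tau\subseteq\partial K$ be a connected subset of length $|\tau|\ge\gamma_1 h_K$. Then every $u\in H^1(K)$ (real-valued) has a trace on $\partial K$ in $L^2(\partial K)$ and, with $$\bar u^K=\frac1{|K|}\int_K u,\qquad \bar u^\tau=\frac1{|\tau|}\int_\tau u\,ds,\qquad |u|_{1,K}^2=\int_K|\nabla u|^2,\qquad \|u\|_{1,K}^2=|\bar u^K|^2+|u|_{1,K}^2,$$ where $u$ on $\tau$ is understood in the sense of traces, one has $$\|u\|_{1,K}^2\le C\left(|\bar u^\tau|^2+|u|_{1,K}^2\right)\qquad\text{and}\qquad |\bar u^\tau|^2+|u|_{1,K}^2\le C\,\|u\|_{1,K}^2 .$$ -/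

import Mathlib

open MeasureTheory Filter Topology Set
open scoped ContDiff Gradient ENNReal

noncomputable section

/-- The Euclidean plane `ℝ²`. -/
abbrev Plane : Type := EuclideanSpace ℝ (Fin 2)

/-- Arc length on subsets of the plane: the one-dimensional Hausdorff measure. -/
def arcLength : Measure Plane := Measure.hausdorffMeasure 1

/-- A closed polygonal chain is simple if it has at least three vertices, these are pairwise
distinct, consecutive edges meet only in their common vertex, and edges which are neither equal
nor consecutive are disjoint. Straight angles are allowed (a vertex may be a hanging node). -/
structure IsSimplePolygon {n : ℕ} (P : Polygon Plane n) : Prop where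
  three_le : 3 ≤ n
  injective : Function.Injective P.vertices
  consecutive : ∀ i : Fin n,
    P.edgeSet ℝ i ∩ P.edgeSet ℝ (finRotate n i) = {P.vertices (finRotate n i)}
  nonconsecutive : ∀ i j : Fin n, j ≠ i → j ≠ finRotate n i → i ≠ finRotate n j →
    Disjoint (P.edgeSet ℝ i) (P.edgeSet ℝ j)

/-- `K` is the (open) polygonal domain bounded by the simple closed polygonal chain `P`. -/
structure IsPolygonalElement {n : ℕ} (P : Polygon Plane n) (K : Set Plane) : Prop where
  simple : IsSimplePolygon P
  isOpen : IsOpen K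
  isConnected : IsConnected K
  isBounded : Bornology.IsBounded K
  frontier_eq : frontier K = P.boundary ℝ

/-- Shape regularity of the polygonal domain `K` with vertices `P`, where `h_K = diam K`:
`K` is star-shaped with respect to (every point of) a ball of radius at least `γ₀ h_K`, and any
two distinct vertices have distance at least `γ₁ h_K`. -/
structure IsShapeRegular (γ₀ γ₁ : ℝ) {n : ℕ} (P : Polygon Plane n) (K : Set Plane) : Prop where
  starShaped : ∃ (c : Plane) (r : ℝ), γ₀ * Metric.diam K ≤ r ∧ Metric.ball c r ⊆ K ∧
    ∀ y ∈ Metric.ball c r, StarConvex ℝ y K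
  vertices_dist : ∀ i j : Fin n, i ≠ j →
    γ₁ * Metric.diam K ≤ dist (P.vertices i) (P.vertices j)

/-- `u` belongs to `H¹(K)` (for `K` open) and `G` is its weak gradient on `K`. -/
structure IsH1WithGradient (K : Set Plane) (u : Plane → ℝ) (G : Plane → Plane) : Prop where
  memLp : MemLp u 2 (volume.restrict K)
  memLp_grad : MemLp G 2 (volume.restrict K)
  integral_by_parts : ∀ φ : Plane → ℝ, ContDiff ℝ ∞ φ → HasCompactSupport φ → tsupport φ ⊆ K →
    ∀ e : Plane, ∫ x in K, u x * fderiv ℝ φ x e = - ∫ x in K, inner ℝ (G x) e * φ x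

/-- `g` is the trace on `∂K` of the `H¹(K)` function `u` with weak gradient `G`: it is the
`L²(∂K)` limit of the boundary values of functions, smooth up to the boundary, which converge to
`u` in `H¹(K)`. -/
def IsTrace (K : Set Plane) (u : Plane → ℝ) (G : Plane → Plane) (g : Plane → ℝ) : Prop :=
  MemLp g 2 (arcLength.restrict (frontier K)) ∧
  ∃ φ : ℕ → Plane → ℝ, (∀ m, ContDiff ℝ ∞ (φ m)) ∧
    Tendsto (fun m => eLpNorm (fun x => φ m x - u x) 2 (volume.restrict K)) atTop (𝓝 0) ∧
    Tendsto (fun m => eLpNorm (fun x => ∇ (φ m) x - G x) 2 (volume.restrict K)) atTop (𝓝 0) ∧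
    Tendsto (fun m => eLpNorm (fun x => φ m x - g x) 2 (arcLength.restrict (frontier K)))
      atTop (𝓝 0)

/-- The square of the `H¹(K)` seminorm, `|u|_{1,K}² = ∫_K |∇u|²`, with `G = ∇u`. -/
def h1SeminormSq (K : Set Plane) (G : Plane → Plane) : ℝ :=
  ∫ x in K, ‖G x‖ ^ 2

/-- `‖u‖_{1,K}² = |ū^K|² + |u|_{1,K}²`, where `ū^K` is the mean of `u` on `K` and `G = ∇u`. -/
def h1NormSq (K : Set Plane) (u : Plane → ℝ) (G : Plane → Plane) : ℝ :=
  |⨍ x in K, u x| ^ 2 + h1SeminormSq K G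

end

/-! Everything reduces to one estimate: the means of `u` over `τ` and over `K` differ by at most
`averageConst γ₀ γ₁` times `|u|_{1,K}`. Squaring it and using `y² ≤ 2x² + 2(x - y)²` gives both
inequalities.

For smooth `φ` both means are compared with the mean over the ball `B` for which `K` is star-shaped,
working in `L¹`. On `K`, `φ x - φ y` with `y ∈ B` is the integral of the derivative along a segment
inside `K`; integrating over `K × B` gives an `L¹` Poincaré inequality
(`lintegral_lintegral_enorm_sub_le`). On the boundary, each edge spans a triangle with apex at the
centre of `B`; its height is at least the radius, and the triangles are disjoint subsets of `K`.
Integrating along the rays from the apex gives an `L¹` trace inequality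
(`IsPolygonalElement.lintegral_frontier_le`) whose constant does not see the number of edges.
Cauchy-Schwarz replaces the `L¹` norm of the gradient by the `L²` norm, and the powers of the
diameter cancel.

General `u` is reached by density: contracting `K` towards the centre leaves room to mollify
(`IsH1WithGradient.exists_contDiff_eLpNorm_sub_le`). The `L¹` trace inequality for `φ²` is a trace
inequality in `L²`, so boundary values of approximating functions are Cauchy and a trace exists. The
mean estimate passes to the limit. -/

noncomputable section

/-! ### Sets that are star-shaped with respect to a ball -/

section Geometry

variable {E : Type*} [NormedAddCommGroup E] [NormedSpace ℝ E]

/-- If `K` is star-shaped with respect to a ball, then segments from a point of the ball to a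
point of the closure of `K` lie in `K`, except possibly for their end point. -/
theorem lineMap_mem_of_starConvex_ball {K : Set E} {c : E} {r : ℝ}
    (hs : ∀ y ∈ Metric.ball c r, StarConvex ℝ y K) {b y : E} (hb : b ∈ Metric.ball c r)
    (hy : y ∈ closure K) {t : ℝ} (h0 : 0 ≤ t) (h1 : t < 1) : b + t • (y - b) ∈ K := by
  -- Since `y` is only in the closure, it is replaced by a nearby `x ∈ K`, and `b` by the point from
  -- which the segment to `x` passes through the same target at time `t`. For `x` near `y` that
  -- point is still in the ball.
  have hcont : Continuous fun x : E => (1 - t)⁻¹ • ((b + t • (y - b)) - t • x) := by fun_prop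
  have h1' : (1 - t) ≠ 0 := by linarith
  have hby : (1 - t)⁻¹ • ((b + t • (y - b)) - t • y) = b := by
    rw [inv_smul_eq_iff₀ h1']
    module
  have hmem : (fun x : E => (1 - t)⁻¹ • ((b + t • (y - b)) - t • x)) ⁻¹' Metric.ball c r ∈ 𝓝 y := by
    apply hcont.continuousAt.preimage_mem_nhds
    rw [hby]
    exact Metric.isOpen_ball.mem_nhds hb
  obtain ⟨x, hx, hxK⟩ := mem_closure_iff_nhds.1 hy _ hmem
  have := hs _ hx hxK (a := 1 - t) (b := t) (by linarith) h0 (by ring)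
  rw [smul_inv_smul₀ h1'] at this
  simpa using this

/-- The perturbation `v` is absorbed by moving the centre to `c + (1 - t)⁻¹ • v`, which stays in the
ball. Thus contracting `K` towards `c` by the factor `t` leaves a margin `(1 - t) * r`, the room
needed for mollification. -/
theorem lineMap_add_mem_of_starConvex_ball {K : Set E} {c : E} {r : ℝ}
    (hs : ∀ y ∈ Metric.ball c r, StarConvex ℝ y K) {x v : E} (hx : x ∈ K)
    {t : ℝ} (h0 : 0 ≤ t) (h1 : t < 1) (hv : ‖v‖ < (1 - t) * r) : c + t • (x - c) + v ∈ K := by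
  have h1' : 0 < 1 - t := by linarith
  have hb : c + (1 - t)⁻¹ • v ∈ Metric.ball c r := by
    rw [Metric.mem_ball, dist_eq_norm, add_sub_cancel_left, norm_smul, norm_inv, Real.norm_eq_abs,
      abs_of_pos h1', inv_mul_lt_iff₀ h1']
    exact hv
  have := hs _ hb hx (a := 1 - t) (b := t) h1'.le h0 (by ring)
  rw [smul_add, smul_inv_smul₀ h1'.ne'] at this
  convert this using 1
  module

/-- Two points of the boundary of `K` on the same ray from the centre coincide. -/
theorem eq_of_smul_eq_of_mem_frontier {K : Set E} {c : E} {r : ℝ} (hr : 0 < r) (hK : IsOpen K)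
    (hs : ∀ y ∈ Metric.ball c r, StarConvex ℝ y K) {y y' : E} (hy : y ∈ frontier K)
    (hy' : y' ∈ frontier K) {t t' : ℝ} (ht : 0 < t) (ht' : 0 < t')
    (h : c + t • (y - c) = c + t' • (y' - c)) : t = t' ∧ y = y' := by
  have key : ∀ {y y' : E} {t t' : ℝ}, y ∈ frontier K → y' ∈ frontier K → 0 < t → 0 < t' →
      c + t • (y - c) = c + t' • (y' - c) → ¬ t < t' := by
    intro y y' t t' hy hy' ht ht' h hlt
    have h2 : t • (y - c) = t' • (y' - c) := add_left_cancel h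
    have hm := lineMap_mem_of_starConvex_ball hs (Metric.mem_ball_self hr)
      (frontier_subset_closure hy) (t := t'⁻¹ * t) (by positivity)
      (by rw [inv_mul_lt_iff₀ ht']; linarith)
    rw [mul_smul, h2, inv_smul_smul₀ ht'.ne', add_sub_cancel] at hm
    rw [hK.frontier_eq] at hy'
    exact hy'.2 hm
  have e : t = t' := le_antisymm (not_lt.1 (key hy' hy ht' ht h.symm))
    (not_lt.1 (key hy hy' ht ht' h))
  subst e
  refine ⟨rfl, ?_⟩
  have := smul_right_injective E ht.ne' (add_left_cancel h)
  exact sub_left_injective this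

/-- A line carrying a nontrivial segment of the boundary does not meet the ball. -/
theorem lineMap_notMem_ball {K : Set E} {c : E} {r : ℝ} (hK : IsOpen K)
    (hB : Metric.ball c r ⊆ K) (hs : ∀ y ∈ Metric.ball c r, StarConvex ℝ y K) {p q : E}
    (hpq : affineSegment ℝ p q ⊆ frontier K) (l : ℝ) :
    p + l • (q - p) ∉ Metric.ball c r := by
  have hfr : ∀ x ∈ frontier K, x ∉ K := fun x hx => by
    rw [hK.frontier_eq] at hx
    exact hx.2
  have hp : p ∈ frontier K := hpq (left_mem_affineSegment ℝ p q)
  have hq : q ∈ frontier K := hpq (right_mem_affineSegment ℝ p q)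
  intro hb
  rcases lt_or_ge l 0 with hl | hl
  -- If the line meets the ball before `p`, then `p` lies strictly between a point of the ball and
  -- `q`, hence in the open set `K`, although it is a boundary point. Beyond `q` the roles of `p`
  -- and `q` are exchanged.
  · have hm := lineMap_mem_of_starConvex_ball hs hb (frontier_subset_closure hq)
      (t := -l / (1 - l)) (div_nonneg (by linarith) (by linarith))
      (by rw [div_lt_one (by linarith)]; linarith)
    refine hfr p hp ?_
    convert hm using 1
    have : (1 - l) ≠ 0 := by linarith
    match_scalars <;> field_simp <;> ring
  · rcases lt_or_ge 1 l with hl1 | hl1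
    · have hm := lineMap_mem_of_starConvex_ball hs hb (frontier_subset_closure hp)
        (t := (l - 1) / l) (div_nonneg (by linarith) (by linarith))
        (by rw [div_lt_one (by linarith)]; linarith)
      refine hfr q hq ?_
      convert hm using 1
      have : l ≠ 0 := by linarith
      match_scalars <;> field_simp <;> ring
    · refine hfr _ (hpq ⟨l, ⟨hl, hl1⟩, ?_⟩) (hB hb)
      rw [AffineMap.lineMap_apply, vsub_eq_sub, vadd_eq_add, add_comm]

end Geometry

/-! ### Triangles over the edges and integration in polar-type coordinates -/

/-- The determinant of two vectors of the plane. -/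
def planeDet (u v : Plane) : ℝ := u 0 * v 1 - u 1 * v 0

/-- The determinant divided by `‖q - p‖` is, up to sign, the distance from `c` to the line through
`p` and `q`, and that line misses the ball. -/
theorem mul_norm_le_abs_planeDet {K : Set Plane} {c : Plane} {r : ℝ} (hr : 0 < r) (hK : IsOpen K)
    (hB : Metric.ball c r ⊆ K) (hs : ∀ y ∈ Metric.ball c r, StarConvex ℝ y K) {p q : Plane}
    (hpq : affineSegment ℝ p q ⊆ frontier K) :
    r * ‖q - p‖ ≤ |planeDet (p - c) (q - p)| := by
  rcases eq_or_ne q p with rfl | hne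
  · simp
  have hv : 0 < ‖q - p‖ := norm_pos_iff.2 (sub_ne_zero.2 hne)
  -- The parameter is that of the foot of the perpendicular from `c`.
  have h := lineMap_notMem_ball hK hB hs hpq
    (((c 0 - p 0) * (q 0 - p 0) + (c 1 - p 1) * (q 1 - p 1)) / ‖q - p‖ ^ 2)
  rw [Metric.mem_ball, not_lt, dist_eq_norm] at h
  have hn : ∀ x : Plane, ‖x‖ ^ 2 = x 0 ^ 2 + x 1 ^ 2 := fun x => by
    rw [EuclideanSpace.norm_sq_eq]; simp
  rw [← sq_le_sq₀ (by positivity) (abs_nonneg _), sq_abs, mul_pow]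
  have h2 := pow_le_pow_left₀ hr.le h 2
  set N := ‖q - p‖ ^ 2 with hN
  have hNpos : 0 < N := by positivity
  have hN2 : N = (q 0 - p 0) ^ 2 + (q 1 - p 1) ^ 2 := by rw [hN, hn]; simp
  refine (mul_le_mul_of_nonneg_right h2 hNpos.le).trans (le_of_eq ?_)
  rw [hn]
  simp only [planeDet, PiLp.sub_apply, PiLp.add_apply, PiLp.smul_apply, smul_eq_mul]
  field_simp
  rw [hN2]
  ring

/-- The open triangle with vertices `c`, `c + u` and `c + u + v`. -/
def openTriangle (c u v : Plane) : Set Plane :=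
  {x | 0 < planeDet u (x - c) / planeDet u v ∧
    planeDet u (x - c) / planeDet u v < planeDet (x - c) v / planeDet u v ∧
    planeDet (x - c) v / planeDet u v < 1}

theorem isOpen_openTriangle (c u v : Plane) : IsOpen (openTriangle c u v) := by
  have h1 : Continuous fun x : Plane => planeDet u (x - c) / planeDet u v := by
    simp only [planeDet, PiLp.sub_apply]; fun_prop
  have h2 : Continuous fun x : Plane => planeDet (x - c) v / planeDet u v := by
    simp only [planeDet, PiLp.sub_apply]; fun_prop
  exact (isOpen_lt continuous_const h1).inter
    ((isOpen_lt h1 h2).inter (isOpen_lt h2 continuous_const))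

theorem add_smul_mem_openTriangle_iff {c u v : Plane} (h : planeDet u v ≠ 0) (a b : ℝ) :
    c + a • u + b • v ∈ openTriangle c u v ↔ 0 < b ∧ b < a ∧ a < 1 := by
  have h1 : planeDet u (c + a • u + b • v - c) / planeDet u v = b := by
    rw [div_eq_iff h]; simp [planeDet]; ring
  have h2 : planeDet (c + a • u + b • v - c) v / planeDet u v = a := by
    rw [div_eq_iff h]; simp [planeDet]; ring
  simp only [openTriangle, mem_ofPred_eq, h1, h2]

/-- These coordinates suit rays: `s` selects a point of the side opposite to `c`, and `t` moves
along the segment from `c` to it. In terms of the linear coordinates, `a = t` and `b = t * s`. -/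
theorem mem_openTriangle_iff_exists {c u v x : Plane} (h : planeDet u v ≠ 0) :
    x ∈ openTriangle c u v ↔
      ∃ t s : ℝ, (0 < t ∧ t < 1) ∧ (0 < s ∧ s < 1) ∧ x = c + t • (u + s • v) := by
  constructor
  · intro hx
    have hx' : x = c + (planeDet (x - c) v / planeDet u v) • u
        + (planeDet u (x - c) / planeDet u v) • v := by
      ext i
      simp only [PiLp.add_apply, PiLp.smul_apply, smul_eq_mul]
      field_simp
      fin_cases i <;> simp [planeDet] <;> ring
    rw [hx', add_smul_mem_openTriangle_iff h] at hx
    obtain ⟨h1, h2, h3⟩ := hx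
    have ha := h1.trans h2
    refine ⟨_, planeDet u (x - c) / planeDet u v / (planeDet (x - c) v / planeDet u v),
      ⟨ha, h3⟩, ⟨div_pos h1 ha, (div_lt_one ha).2 h2⟩, ?_⟩
    rw [smul_add, smul_smul, mul_div_cancel₀ _ ha.ne', ← add_assoc]
    exact hx'
  · rintro ⟨t, s, ⟨h1, h2⟩, ⟨h3, h4⟩, rfl⟩
    rw [smul_add, smul_smul, ← add_assoc, add_smul_mem_openTriangle_iff h]
    exact ⟨by positivity, by nlinarith, h2⟩

theorem lintegral_plane_comp (c u v : Plane) (h : planeDet u v ≠ 0) {f : Plane → ℝ≥0∞}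
    (hf : Measurable f) :
    ∫⁻ x, f x = ENNReal.ofReal |planeDet u v| * ∫⁻ a : ℝ, ∫⁻ b : ℝ, f (c + a • u + b • v) := by
  let M : Plane →ₗ[ℝ] Plane :=
    { toFun := fun x => x 0 • u + x 1 • v
      map_add' := fun x y => by simp only [PiLp.add_apply]; module
      map_smul' := fun k x => by
        simp only [PiLp.smul_apply, RingHom.id_apply, smul_eq_mul]; module }
  have hM : LinearMap.det M = planeDet u v := by
    rw [← LinearMap.det_toMatrix (EuclideanSpace.basisFun (Fin 2) ℝ).toBasis, Matrix.det_fin_two]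
    simp [LinearMap.toMatrix_apply, M, planeDet]
    ring
  have hMm : Measurable M := M.continuous_of_finiteDimensional.measurable
  have e1 : ∫⁻ x, f (c + M x) = ENNReal.ofReal |(planeDet u v)⁻¹| * ∫⁻ x, f x := by
    have : ∫⁻ x, f (c + M x) = ∫⁻ y, f (c + y) ∂(Measure.map M volume) :=
      (lintegral_map (hf.comp (measurable_const_add c)) hMm).symm
    rw [this, Measure.map_linearMap_addHaar_eq_smul_addHaar volume (hM ▸ h), hM,
      lintegral_smul_measure, smul_eq_mul, lintegral_add_left_eq_self f c]
  have hmp : MeasurePreserving (fun x : Plane => (x 0, x 1)) volume volume :=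
    (volume_preserving_finTwoArrow ℝ).comp
      (EuclideanSpace.volume_preserving_symm_measurableEquiv_toLp (Fin 2))
  have hm2 : Measurable fun z : ℝ × ℝ => f (c + z.1 • u + z.2 • v) :=
    hf.comp (by fun_prop)
  have e2 : ∫⁻ x, f (c + M x) = ∫⁻ a : ℝ, ∫⁻ b : ℝ, f (c + a • u + b • v) := by
    have := hmp.lintegral_comp hm2
    rw [Measure.volume_eq_prod, lintegral_prod _ hm2.aemeasurable] at this
    rw [← this]
    simp only [M, LinearMap.coe_mk, AddHom.coe_mk, add_assoc]
  rw [← e2, e1, ← mul_assoc, ← ENNReal.ofReal_mul (abs_nonneg _), ← abs_mul, mul_inv_cancel₀ h]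
  simp

theorem lintegral_Ioo_zero_eq {a : ℝ} (ha : 0 < a) {f : ℝ → ℝ≥0∞} (hf : Measurable f) :
    ∫⁻ b in Ioo 0 a, f b = ENNReal.ofReal a * ∫⁻ s in Ioo 0 1, f (a * s) := by
  have h := Real.smul_map_volume_mul_left ha.ne'
  rw [abs_of_pos ha] at h
  have hpre : (fun s => a * s) ⁻¹' Ioo 0 a = Ioo 0 1 := by
    ext s
    simp only [mem_preimage, mem_Ioo]
    constructor
    · rintro ⟨h1, h2⟩
      exact ⟨by nlinarith [pos_of_mul_pos_right h1 ha.le], by nlinarith⟩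
    · rintro ⟨h1, h2⟩
      exact ⟨by positivity, by nlinarith⟩
  conv_lhs => rw [← h]
  rw [Measure.restrict_smul, lintegral_smul_measure,
    Measure.restrict_map (measurable_const_mul a) measurableSet_Ioo, hpre,
    lintegral_map hf (measurable_const_mul a), smul_eq_mul]

/-- The substitution `b = t * s` contributes the Jacobian factor `t`, which reappears as the weight
in `enorm_le_lintegral_ray`. -/
theorem lintegral_openTriangle {c u v : Plane} (h : planeDet u v ≠ 0) {f : Plane → ℝ≥0∞}
    (hf : Measurable f) :
    ∫⁻ x in openTriangle c u v, f x = ENNReal.ofReal |planeDet u v| *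
      ∫⁻ t in Ioo (0 : ℝ) 1, ∫⁻ s in Ioo (0 : ℝ) 1, ENNReal.ofReal t * f (c + t • (u + s • v)) := by
  have hT := (isOpen_openTriangle c u v).measurableSet
  rw [← lintegral_indicator hT, lintegral_plane_comp c u v h (hf.indicator hT)]
  congr 1
  rw [← lintegral_indicator measurableSet_Ioo]
  refine lintegral_congr fun a => ?_
  by_cases ha : a ∈ Ioo (0 : ℝ) 1
  · rw [indicator_of_mem ha]
    have hm : Measurable fun b : ℝ => f (c + a • u + b • v) := hf.comp (by fun_prop)
    have : ∀ b : ℝ, (openTriangle c u v).indicator f (c + a • u + b • v) =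
        (Ioo 0 a).indicator (fun b => f (c + a • u + b • v)) b := fun b => by
      have := add_smul_mem_openTriangle_iff (c := c) h a b
      by_cases hb : b ∈ Ioo 0 a
      · rw [indicator_of_mem hb, indicator_of_mem (this.2 ⟨hb.1, hb.2, ha.2⟩)]
      · rw [indicator_of_notMem hb, indicator_of_notMem fun hc => hb ?_]
        exact ⟨(this.1 hc).1, (this.1 hc).2.1⟩
    rw [lintegral_congr this, lintegral_indicator measurableSet_Ioo, lintegral_Ioo_zero_eq ha.1 hm,
      ← lintegral_const_mul _ (f := fun s => f (c + a • u + (a * s) • v))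
        (hm.comp (measurable_const_mul a))]
    refine lintegral_congr fun s => ?_
    rw [smul_add, smul_smul, ← add_assoc]
  · rw [indicator_of_notMem ha]
    refine (lintegral_congr fun b => indicator_of_notMem (fun hc => ha ?_) f).trans lintegral_zero
    obtain ⟨h1, h2, h3⟩ := (add_smul_mem_openTriangle_iff (c := c) h a b).1 hc
    exact ⟨h1.trans h2, h3⟩

theorem setLIntegral_affineSegment_arcLength_le (p q : Plane) {f : Plane → ℝ≥0∞}
    (hf : Measurable f) :
    ∫⁻ x in affineSegment ℝ p q, f x ∂arcLength ≤
      ENNReal.ofReal ‖q - p‖ * ∫⁻ s in Ioo (0 : ℝ) 1, f (p + s • (q - p)) := by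
  have hc : Continuous fun s : ℝ => p + s • (q - p) := by fun_prop
  have hlm : ⇑(AffineMap.lineMap p q : ℝ →ᵃ[ℝ] Plane) = fun s : ℝ => p + s • (q - p) := by
    ext1 s
    rw [AffineMap.lineMap_apply, vsub_eq_sub, vadd_eq_add, add_comm]
  have hle : arcLength.restrict (affineSegment ℝ p q) ≤
      ENNReal.ofReal ‖q - p‖ •
        Measure.map (fun s : ℝ => p + s • (q - p)) (volume.restrict (Icc 0 1)) := by
    refine Measure.le_iff.2 fun A hA => ?_
    rw [Measure.restrict_apply hA, Measure.smul_apply, Measure.map_apply hc.measurable hA,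
      Measure.restrict_apply (hc.measurable hA), affineSegment, hlm, inter_comm A,
      ← image_inter_preimage, inter_comm (Icc _ _)]
    have := hausdorffMeasure_lineMap_image p q (((fun s : ℝ => p + s • (q - p)) ⁻¹' A) ∩ Icc 0 1)
    rw [hlm, hausdorffMeasure_real] at this
    rw [arcLength, this, nndist_comm, nndist_eq_nnnorm, ENNReal.smul_def, smul_eq_mul,
      smul_eq_mul, ofReal_norm, enorm_eq_nnnorm]
  refine (lintegral_mono' hle le_rfl).trans (le_of_eq ?_)
  rw [lintegral_smul_measure, lintegral_map hf hc.measurable, smul_eq_mul,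
    restrict_Ioo_eq_restrict_Icc]

/-! ### Values of a smooth function as integrals along segments -/

section Rays

variable {E : Type*} [NormedAddCommGroup E] [NormedSpace ℝ E]

theorem hasDerivAt_comp_lineMap {ψ : E → ℝ} (hψ : ContDiff ℝ 1 ψ) (c v : E) (t : ℝ) :
    HasDerivAt (fun t : ℝ => ψ (c + t • v)) (fderiv ℝ ψ (c + t • v) v) t := by
  have h1 : HasDerivAt (fun t : ℝ => c + t • v) v t := by
    simpa using ((hasDerivAt_id t).smul_const v).const_add c
  exact ((hψ.differentiable one_ne_zero (c + t • v)).hasFDerivAt).comp_hasDerivAt t h1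

/-- The fundamental theorem of calculus is applied to `t² ψ(c + t (y - c))`. The factor `t²` removes
the contribution at `c` and leaves a weight of at most `t` after differentiation (`t² ≤ t` on the
gradient term), matching the Jacobian of the triangle coordinates. -/
theorem enorm_le_lintegral_ray {ψ : E → ℝ} (hψ : ContDiff ℝ 1 ψ) (c y : E) :
    ‖ψ y‖ₑ ≤ ∫⁻ t in Ioo (0 : ℝ) 1, ENNReal.ofReal t *
      (2 * ‖ψ (c + t • (y - c))‖ₑ + ‖y - c‖ₑ * ‖fderiv ℝ ψ (c + t • (y - c))‖ₑ) := by
  have hf' : Continuous (fderiv ℝ ψ) := hψ.continuous_fderiv one_ne_zero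
  have hψc := hψ.continuous
  have hd : ∀ t ∈ uIcc (0 : ℝ) 1, HasDerivAt (fun t : ℝ => t ^ 2 * ψ (c + t • (y - c)))
      (2 * t * ψ (c + t • (y - c)) + t ^ 2 * fderiv ℝ ψ (c + t • (y - c)) (y - c)) t := by
    intro t _
    have := (hasDerivAt_pow 2 t).fun_mul (hasDerivAt_comp_lineMap hψ c (y - c) t)
    simpa using this
  have hc : Continuous fun t : ℝ =>
      2 * t * ψ (c + t • (y - c)) + t ^ 2 * fderiv ℝ ψ (c + t • (y - c)) (y - c) := by fun_prop
  have h := intervalIntegral.integral_eq_sub_of_hasDerivAt hd (hc.intervalIntegrable 0 1)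
  simp only [one_pow, one_smul, add_sub_cancel, one_mul, ne_eq, OfNat.ofNat_ne_zero,
    not_false_eq_true, zero_pow, zero_mul, sub_zero] at h
  rw [← h, intervalIntegral.integral_of_le zero_le_one, restrict_Ioo_eq_restrict_Ioc]
  refine (enorm_integral_le_lintegral_enorm _).trans
    (setLIntegral_mono_ae' measurableSet_Ioc (.of_forall fun t ht => ?_))
  have e1 : ‖t‖ₑ = ENNReal.ofReal t := Real.enorm_of_nonneg ht.1.le
  refine (enorm_add_le _ _).trans ?_
  rw [mul_add]
  refine add_le_add ?_ ?_
  · rw [enorm_mul, enorm_mul, e1, Real.enorm_of_nonneg zero_le_two]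
    simp only [ENNReal.ofReal_ofNat]
    exact le_of_eq (by ring)
  · rw [enorm_mul, enorm_pow, e1]
    refine mul_le_mul' ?_ ?_
    · rw [sq]
      exact mul_le_of_le_one_right' (ENNReal.ofReal_le_one.2 ht.2)
    · rw [mul_comm]
      exact ContinuousLinearMap.le_opENorm _ _

theorem enorm_sub_le_lintegral_segment {ψ : E → ℝ} (hψ : ContDiff ℝ 1 ψ) (x y : E) :
    ‖ψ x - ψ y‖ₑ ≤ ‖x - y‖ₑ * ∫⁻ t in Ioo (0 : ℝ) 1, ‖fderiv ℝ ψ (y + t • (x - y))‖ₑ := by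
  have hf' : Continuous (fderiv ℝ ψ) := hψ.continuous_fderiv one_ne_zero
  have hc : Continuous fun t : ℝ => fderiv ℝ ψ (y + t • (x - y)) (x - y) := by fun_prop
  have h := intervalIntegral.integral_eq_sub_of_hasDerivAt
    (fun t _ => hasDerivAt_comp_lineMap hψ y (x - y) t) (hc.intervalIntegrable 0 1)
  simp only [one_smul, add_sub_cancel, zero_smul, add_zero] at h
  rw [← h, intervalIntegral.integral_of_le zero_le_one, restrict_Ioo_eq_restrict_Ioc,
    ← lintegral_const_mul' _ _ enorm_ne_top]
  refine (enorm_integral_le_lintegral_enorm _).trans (lintegral_mono fun t => ?_)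
  rw [mul_comm]
  exact ContinuousLinearMap.le_opENorm _ _

end Rays

theorem measurable_trace_integrand {ψ : Plane → ℝ} (hψ : ContDiff ℝ 1 ψ) (h : ℝ≥0∞) :
    Measurable fun x => 2 * ‖ψ x‖ₑ + h * ‖fderiv ℝ ψ x‖ₑ := by
  have hf' : Continuous (fderiv ℝ ψ) := hψ.continuous_fderiv one_ne_zero
  have h1 : Measurable fun x => ‖ψ x‖ₑ := hψ.continuous.measurable.enorm
  have h2 : Measurable fun x => ‖fderiv ℝ ψ x‖ₑ := hf'.measurable.enorm
  exact (h1.const_mul _).add (h2.const_mul _)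

/-- The ray estimate is integrated over the points of the edge. In the triangle coordinates the
right-hand side is the same double integral with prefactor `|planeDet|`, while arc length gives `‖q
- p‖`; `hr` compares the two. -/
theorem setLIntegral_affineSegment_le_openTriangle {ψ : Plane → ℝ} (hψ : ContDiff ℝ 1 ψ)
    {c p q : Plane} {r : ℝ} {h : ℝ≥0∞} (hd : planeDet (p - c) (q - p) ≠ 0)
    (hr : r * ‖q - p‖ ≤ |planeDet (p - c) (q - p)|)
    (hh : ∀ y ∈ affineSegment ℝ p q, ‖y - c‖ₑ ≤ h) :
    ENNReal.ofReal r * ∫⁻ x in affineSegment ℝ p q, ‖ψ x‖ₑ ∂arcLength ≤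
      ∫⁻ x in openTriangle c (p - c) (q - p), (2 * ‖ψ x‖ₑ + h * ‖fderiv ℝ ψ x‖ₑ) := by
  have hf := measurable_trace_integrand hψ h
  have hψm : Measurable fun x => ‖ψ x‖ₑ := hψ.continuous.measurable.enorm
  refine (mul_le_mul_right (setLIntegral_affineSegment_arcLength_le p q hψm) _).trans ?_
  rw [← mul_assoc, ← ENNReal.ofReal_mul' (norm_nonneg _), lintegral_openTriangle hd hf]
  refine mul_le_mul' (ENNReal.ofReal_le_ofReal hr) ?_
  have hmeas : Measurable (Function.uncurry fun t s : ℝ => ENNReal.ofReal t *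
      (fun x => 2 * ‖ψ x‖ₑ + h * ‖fderiv ℝ ψ x‖ₑ) (c + t • (p - c + s • (q - p)))) := by
    refine (ENNReal.measurable_ofReal.comp measurable_fst).mul (hf.comp ?_)
    exact Continuous.measurable (by fun_prop)
  rw [lintegral_lintegral_swap hmeas.aemeasurable]
  refine setLIntegral_mono_ae' measurableSet_Ioo (.of_forall fun s hs => ?_)
  have hmem : p + s • (q - p) ∈ affineSegment ℝ p q := by
    refine ⟨s, ⟨hs.1.le, hs.2.le⟩, ?_⟩
    rw [AffineMap.lineMap_apply, vsub_eq_sub, vadd_eq_add, add_comm]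
  refine (enorm_le_lintegral_ray hψ c (p + s • (q - p))).trans (lintegral_mono fun t => ?_)
  have e : p + s • (q - p) - c = p - c + s • (q - p) := by abel
  dsimp only
  rw [← e]
  gcongr
  exact hh _ hmem

/-! ### The trace inequality in `L¹` -/

theorem IsSimplePolygon.vertices_ne {n : ℕ} {P : Polygon Plane n} (hP : IsSimplePolygon P)
    (i : Fin n) : P.vertices i ≠ P.vertices (finRotate n i) := by
  intro h
  have h3 := hP.three_le
  obtain ⟨m, rfl⟩ : ∃ m, n = m + 1 := ⟨n - 1, by omega⟩
  have h' := hP.injective h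
  rw [finRotate_apply] at h'
  have : (1 : Fin (m + 1)) = 0 := by simpa using h'.symm
  have := congrArg Fin.val this
  rw [Fin.val_one', Fin.val_zero, Nat.mod_eq_of_lt (by omega)] at this
  omega

/-- Two edges do not share points in their relative interiors. -/
theorem IsSimplePolygon.eq_of_mem_edges {n : ℕ} {P : Polygon Plane n} (hP : IsSimplePolygon P)
    {i j : Fin n} {s s' : ℝ} (hs : s ∈ Ioo (0 : ℝ) 1) (hs' : s' ∈ Ioo (0 : ℝ) 1)
    (h : AffineMap.lineMap (P.vertices i) (P.vertices (finRotate n i)) s =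
      AffineMap.lineMap (P.vertices j) (P.vertices (finRotate n j)) s') : i = j := by
  have hmem : ∀ {i : Fin n} {s : ℝ}, s ∈ Ioo (0 : ℝ) 1 →
      AffineMap.lineMap (P.vertices i) (P.vertices (finRotate n i)) s ∈ P.edgeSet ℝ i :=
    fun hs => ⟨_, ⟨hs.1.le, hs.2.le⟩, rfl⟩
  have key : ∀ {i : Fin n} {s : ℝ}, s ∈ Ioo (0 : ℝ) 1 →
      AffineMap.lineMap (P.vertices i) (P.vertices (finRotate n i)) s ∉
        P.edgeSet ℝ (finRotate n i) := by
    intro i s hs hc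
    have := (hP.consecutive i).subset ⟨hmem hs, hc⟩
    rw [mem_singleton_iff] at this
    have h1 : AffineMap.lineMap (P.vertices i) (P.vertices (finRotate n i)) s =
      AffineMap.lineMap (P.vertices i) (P.vertices (finRotate n i)) (1 : ℝ) := by
      rw [this, AffineMap.lineMap_apply_one]
    exact hs.2.ne (AffineMap.lineMap_injective ℝ (hP.vertices_ne i) h1)
  by_contra hij
  by_cases h1 : j = finRotate n i
  · exact key hs (h ▸ congrArg (P.edgeSet ℝ) h1 ▸ hmem hs')
  by_cases h2 : i = finRotate n j
  · exact key hs' (h.symm ▸ congrArg (P.edgeSet ℝ) h2 ▸ hmem hs)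
  exact (hP.nonconsecutive i j (Ne.symm hij) h1 h2).le_bot ⟨hmem hs, h ▸ hmem hs'⟩

/-- The trace inequality in `L¹` on a polygon which is star-shaped with respect to a ball. -/
theorem IsPolygonalElement.lintegral_frontier_le {n : ℕ} {P : Polygon Plane n} {K : Set Plane}
    (hP : IsPolygonalElement P K) {c : Plane} {r : ℝ} (hr : 0 < r) (hB : Metric.ball c r ⊆ K)
    (hs : ∀ y ∈ Metric.ball c r, StarConvex ℝ y K) {ψ : Plane → ℝ} (hψ : ContDiff ℝ 1 ψ) :
    ENNReal.ofReal r * ∫⁻ x in frontier K, ‖ψ x‖ₑ ∂arcLength ≤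
      ∫⁻ x in K, (2 * ‖ψ x‖ₑ + ENNReal.ofReal (Metric.diam K) * ‖fderiv ℝ ψ x‖ₑ) := by
  have hedge : ∀ i, affineSegment ℝ (P.vertices i) (P.vertices (finRotate n i)) ⊆ frontier K := by
    intro i
    rw [hP.frontier_eq]
    exact subset_iUnion (fun i => P.edgeSet ℝ i) i
  have hdet : ∀ i, r * ‖P.vertices (finRotate n i) - P.vertices i‖ ≤
      |planeDet (P.vertices i - c) (P.vertices (finRotate n i) - P.vertices i)| := fun i =>
    mul_norm_le_abs_planeDet hr hP.isOpen hB hs (hedge i)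
  have hdet0 : ∀ i, planeDet (P.vertices i - c)
      (P.vertices (finRotate n i) - P.vertices i) ≠ 0 := fun i => by
    have : 0 < ‖P.vertices (finRotate n i) - P.vertices i‖ :=
      norm_pos_iff.2 (sub_ne_zero.2 (hP.simple.vertices_ne i).symm)
    exact abs_pos.1 (lt_of_lt_of_le (by positivity) (hdet i))
  have hdiam : ∀ y ∈ frontier K, ‖y - c‖ₑ ≤ ENNReal.ofReal (Metric.diam K) := by
    intro y hy
    rw [← ofReal_norm, ← dist_eq_norm]
    refine ENNReal.ofReal_le_ofReal ?_
    rw [← Metric.diam_closure]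
    exact Metric.dist_le_diam_of_mem hP.isBounded.closure (frontier_subset_closure hy)
      (subset_closure (hB (Metric.mem_ball_self hr)))
  have hline : ∀ i (s : ℝ), c + (P.vertices i - c + s • (P.vertices (finRotate n i) - P.vertices i))
      = AffineMap.lineMap (P.vertices i) (P.vertices (finRotate n i)) s := fun i s => by
    rw [AffineMap.lineMap_apply, vsub_eq_sub, vadd_eq_add]
    abel
  set T : Fin n → Set Plane := fun i =>
    openTriangle c (P.vertices i - c) (P.vertices (finRotate n i) - P.vertices i) with hT
  have hTmem : ∀ i x, x ∈ T i → ∃ t s : ℝ, (0 < t ∧ t < 1) ∧ s ∈ Ioo (0 : ℝ) 1 ∧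
      x = c + t • (AffineMap.lineMap (P.vertices i) (P.vertices (finRotate n i)) s - c) := by
    intro i x hx
    obtain ⟨t, s, ht, hs', rfl⟩ := (mem_openTriangle_iff_exists (hdet0 i)).1 hx
    exact ⟨t, s, ht, hs', by rw [← hline, add_sub_cancel_left]⟩
  have hfr : ∀ i (s : ℝ), s ∈ Ioo (0 : ℝ) 1 →
      AffineMap.lineMap (P.vertices i) (P.vertices (finRotate n i)) s ∈ frontier K :=
    fun i s hs' => hedge i ⟨s, ⟨hs'.1.le, hs'.2.le⟩, rfl⟩
  have hTK : ⋃ i, T i ⊆ K := by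
    refine iUnion_subset fun i x hx => ?_
    obtain ⟨t, s, ht, hs', rfl⟩ := hTmem i x hx
    exact lineMap_mem_of_starConvex_ball hs (Metric.mem_ball_self hr)
      (frontier_subset_closure (hfr i s hs')) ht.1.le ht.2
  -- A common point of two triangles lies on rays to relative interior points of both edges. A ray
  -- meets the boundary only once, so these points agree, and the edges are equal. Disjointness and
  -- inclusion in `K` suffice; the triangles need not be shown to cover `K`.
  have hTd : Pairwise fun i j => Disjoint (T i) (T j) := by
    intro i j hij
    refine Set.disjoint_left.2 fun x hxi hxj => hij ?_
    obtain ⟨t, s, ht, hs1, rfl⟩ := hTmem i x hxi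
    obtain ⟨t', s', ht', hs2, he⟩ := hTmem j _ hxj
    exact hP.simple.eq_of_mem_edges hs1 hs2 (eq_of_smul_eq_of_mem_frontier hr hP.isOpen hs
      (hfr i s hs1) (hfr j s' hs2) ht.1 ht'.1 he).2
  calc ENNReal.ofReal r * ∫⁻ x in frontier K, ‖ψ x‖ₑ ∂arcLength
      ≤ ENNReal.ofReal r * ∑ i, ∫⁻ x in P.edgeSet ℝ i, ‖ψ x‖ₑ ∂arcLength := by
        rw [hP.frontier_eq, Polygon.boundary]
        refine mul_le_mul_right ((lintegral_iUnion_le _ _).trans (le_of_eq ?_)) _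
        rw [tsum_fintype]
    _ ≤ ∑ i, ∫⁻ x in T i, (2 * ‖ψ x‖ₑ + ENNReal.ofReal (Metric.diam K) * ‖fderiv ℝ ψ x‖ₑ) := by
        rw [Finset.mul_sum]
        exact Finset.sum_le_sum fun i _ => setLIntegral_affineSegment_le_openTriangle hψ
          (hdet0 i) (hdet i) fun y hy => hdiam y (hedge i hy)
    _ = ∫⁻ x in ⋃ i, T i, (2 * ‖ψ x‖ₑ + ENNReal.ofReal (Metric.diam K) * ‖fderiv ℝ ψ x‖ₑ) := by
        rw [lintegral_iUnion (fun i => (isOpen_openTriangle _ _ _).measurableSet) hTd, tsum_fintype]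
    _ ≤ _ := lintegral_mono_set hTK

theorem IsPolygonalElement.arcLength_frontier_lt_top {n : ℕ} {P : Polygon Plane n} {K : Set Plane}
    (hP : IsPolygonalElement P K) : arcLength (frontier K) < ⊤ := by
  rw [hP.frontier_eq, Polygon.boundary]
  refine (measure_iUnion_le _).trans_lt ?_
  rw [tsum_fintype]
  refine ENNReal.sum_lt_top.2 fun i _ => ?_
  rw [arcLength, Polygon.edgeSet, hausdorffMeasure_affineSegment]
  exact edist_lt_top _ _

/-! ### The Poincaré inequality in `L¹` -/

theorem lintegral_comp_smul_add {a : ℝ} (ha : a ≠ 0) (z : Plane) (f : Plane → ℝ≥0∞) :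
    ∫⁻ x, f (a • x + z) = ENNReal.ofReal (a ^ 2)⁻¹ * ∫⁻ x, f x := by
  have h1 : ∫⁻ x, f (a • x + z) = ∫⁻ x, f (x + z) ∂(Measure.map (a • ·) volume) :=
    ((Homeomorph.smulOfNeZero a ha).measurableEmbedding.lintegral_map fun x => f (x + z)).symm
  rw [h1, Measure.map_addHaar_smul volume ha, lintegral_smul_measure,
    lintegral_add_right_eq_self f z, finrank_euclideanSpace_fin, smul_eq_mul,
    abs_of_nonneg (by positivity)]

theorem setLIntegral_comp_smul_add_le {a : ℝ} (ha : a ≠ 0) (z : Plane) (f : Plane → ℝ≥0∞)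
    {A K : Set Plane} (hA : MeasurableSet A) (hK : MeasurableSet K)
    (h : ∀ x ∈ A, a • x + z ∈ K) :
    ∫⁻ x in A, f (a • x + z) ≤ ENNReal.ofReal (a ^ 2)⁻¹ * ∫⁻ x in K, f x := by
  rw [← lintegral_indicator hK, ← lintegral_comp_smul_add ha z]
  refine (setLIntegral_mono_ae' hA (.of_forall fun x hx => ?_)).trans
    (setLIntegral_le_lintegral A _)
  rw [indicator_of_mem (h x hx)]

/-- A Poincaré inequality in `L¹`, for differences of values on a domain and on a ball with respect
to which the domain is star-shaped. -/
theorem lintegral_lintegral_enorm_sub_le {K : Set Plane} (hK : IsOpen K)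
    (hKb : Bornology.IsBounded K) {c : Plane} {r : ℝ} (hB : Metric.ball c r ⊆ K)
    (hs : ∀ y ∈ Metric.ball c r, StarConvex ℝ y K) {φ : Plane → ℝ} (hφ : ContDiff ℝ 1 φ) :
    ∫⁻ x in K, ∫⁻ y in Metric.ball c r, ‖φ x - φ y‖ₑ ≤
      ENNReal.ofReal (Metric.diam K) * (4 * (volume K + volume (Metric.ball c r)) *
        ∫⁻ x in K, ‖fderiv ℝ φ x‖ₑ) := by
  set g : Plane → ℝ≥0∞ := fun x => ‖fderiv ℝ φ x‖ₑ with hg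
  have hgm : Measurable g := (hφ.continuous_fderiv one_ne_zero).measurable.enorm
  set B := Metric.ball c r with hBdef
  have hBm : MeasurableSet B := Metric.isOpen_ball.measurableSet
  set I := ∫⁻ x in K, g x with hI
  have hmem : ∀ x ∈ K, ∀ y ∈ B, ∀ t ∈ Ioo (0 : ℝ) 1, y + t • (x - y) ∈ K :=
    fun x hx y hy t ht => lineMap_mem_of_starConvex_ball hs hy (subset_closure hx) ht.1.le ht.2
  have hJ : ∀ t ∈ Ioo (0 : ℝ) 1, ∫⁻ x in K, ∫⁻ y in B, g (y + t • (x - y)) ≤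
      4 * (volume K + volume B) * I := by
    intro t ht
    have hbound : ∀ a : ℝ, 1 / 2 ≤ a → ENNReal.ofReal (a ^ 2)⁻¹ ≤ 4 := fun a ha => by
      rw [← ENNReal.ofReal_ofNat 4]
      refine ENNReal.ofReal_le_ofReal ?_
      rw [inv_le_comm₀ (by positivity) (by norm_num)]
      nlinarith
    -- The point `y + t (x - y)` is a dilation of `y` by `1 - t` and of `x` by `t`. Integrating
    -- first in the variable with the larger factor keeps the Jacobian, `(1 - t)⁻²` or `t⁻²`, below
    -- `4`.
    rcases le_total t (1 / 2) with h | h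
    · calc ∫⁻ x in K, ∫⁻ y in B, g (y + t • (x - y))
          ≤ ∫⁻ x in K, 4 * I := by
            refine setLIntegral_mono_ae' hK.measurableSet (.of_forall fun x hx => ?_)
            have e : ∀ y, y + t • (x - y) = (1 - t) • y + t • x := fun y => by module
            simp only [e]
            refine (setLIntegral_comp_smul_add_le (by linarith [ht.2]) (t • x) g hBm
              hK.measurableSet fun y hy => ?_).trans
              (mul_le_mul_left (hbound (1 - t) (by linarith)) _)
            rw [← e]
            exact hmem x hx y hy t ht
        _ = 4 * volume K * I := by rw [setLIntegral_const]; ring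
        _ ≤ _ := by gcongr; exact le_self_add
    · have hm : Measurable (Function.uncurry fun x y : Plane => g (y + t • (x - y))) :=
        hgm.comp (Continuous.measurable (by fun_prop))
      rw [lintegral_lintegral_swap hm.aemeasurable]
      calc ∫⁻ y in B, ∫⁻ x in K, g (y + t • (x - y))
          ≤ ∫⁻ y in B, 4 * I := by
            refine setLIntegral_mono_ae' hBm (.of_forall fun y hy => ?_)
            have e : ∀ x, y + t • (x - y) = t • x + (1 - t) • y := fun x => by module
            simp only [e]
            refine (setLIntegral_comp_smul_add_le ht.1.ne' ((1 - t) • y) g hK.measurableSet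
              hK.measurableSet fun x hx => ?_).trans (mul_le_mul_left (hbound t h) _)
            rw [← e]
            exact hmem x hx y hy t ht
        _ = 4 * volume B * I := by rw [setLIntegral_const]; ring
        _ ≤ _ := by gcongr; exact le_add_self
  calc ∫⁻ x in K, ∫⁻ y in B, ‖φ x - φ y‖ₑ
      ≤ ∫⁻ x in K, ∫⁻ y in B, ENNReal.ofReal (Metric.diam K) *
          ∫⁻ t in Ioo (0 : ℝ) 1, g (y + t • (x - y)) := by
        refine setLIntegral_mono_ae' hK.measurableSet (.of_forall fun x hx => ?_)
        refine setLIntegral_mono_ae' hBm (.of_forall fun y hy => ?_)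
        refine (enorm_sub_le_lintegral_segment hφ x y).trans (mul_le_mul_left ?_ _)
        rw [← ofReal_norm, ← dist_eq_norm]
        exact ENNReal.ofReal_le_ofReal (Metric.dist_le_diam_of_mem hKb hx (hB hy))
    _ = ENNReal.ofReal (Metric.diam K) *
          ∫⁻ x in K, ∫⁻ y in B, ∫⁻ t in Ioo (0 : ℝ) 1, g (y + t • (x - y)) := by
        simp only [lintegral_const_mul' _ _ ENNReal.ofReal_ne_top]
    _ = ENNReal.ofReal (Metric.diam K) *
          ∫⁻ t in Ioo (0 : ℝ) 1, ∫⁻ x in K, ∫⁻ y in B, g (y + t • (x - y)) := by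
        congr 1
        have hm : Measurable fun z : (Plane × ℝ) × Plane => g (z.2 + z.1.2 • (z.1.1 - z.2)) :=
          hgm.comp (Continuous.measurable (by fun_prop))
        have hm1 : ∀ x : Plane, Measurable
            (Function.uncurry fun (y : Plane) (t : ℝ) => g (y + t • (x - y))) := fun x =>
          hgm.comp (Continuous.measurable (by fun_prop))
        exact (lintegral_congr fun x => lintegral_lintegral_swap (hm1 x).aemeasurable).trans
          (lintegral_lintegral_swap
            (hm.lintegral_prod_right' (ν := volume.restrict B)).aemeasurable)
    _ ≤ ENNReal.ofReal (Metric.diam K) *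
          ∫⁻ t in Ioo (0 : ℝ) 1, 4 * (volume K + volume B) * I := by
        exact mul_le_mul_right (setLIntegral_mono_ae' measurableSet_Ioo (.of_forall hJ)) _
    _ = _ := by
        rw [setLIntegral_const, Real.volume_Ioo]
        simp

/-! ### Comparison of mean values for smooth functions -/

theorem enorm_average_sub_le {α : Type*} [MeasurableSpace α] {μ : Measure α} [IsFiniteMeasure μ]
    (hμ : μ ≠ 0) {f : α → ℝ} (hf : Integrable f μ) (a : ℝ) :
    ‖(⨍ x, f x ∂μ) - a‖ₑ ≤ (μ univ)⁻¹ * ∫⁻ x, ‖f x - a‖ₑ ∂μ := by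
  have : NeZero μ := ⟨hμ⟩
  have h : (⨍ x, f x ∂μ) - a = ⨍ x, (f x - a) ∂μ := by
    rw [average, average, integral_sub, ← average, ← average, average_const]
    · exact hf.to_average
    · exact integrable_const a
  rw [h, average]
  refine (enorm_integral_le_lintegral_enorm _).trans (le_of_eq ?_)
  rw [lintegral_smul_measure, smul_eq_mul]

theorem ofReal_sq_le_volume_ball (c : Plane) {r : ℝ} (hr : 0 ≤ r) :
    ENNReal.ofReal (r ^ 2) ≤ volume (Metric.ball c r) := by
  rw [EuclideanSpace.volume_ball_fin_two, ENNReal.ofReal_pow hr]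
  refine le_mul_of_one_le_right' ?_
  rw [ENNReal.one_le_ofReal]
  linarith [Real.pi_gt_three]

theorem volume_le_ofReal_diam_sq {K : Set Plane} (hK : Bornology.IsBounded K) :
    volume K ≤ ENNReal.ofReal (4 * Metric.diam K ^ 2) := by
  rcases K.eq_empty_or_nonempty with rfl | ⟨x, hx⟩
  · simp
  have hsub : K ⊆ Metric.closedBall x (Metric.diam K) := fun y hy =>
    Metric.mem_closedBall.2 (Metric.dist_le_diam_of_mem hK hy hx)
  refine (measure_mono hsub).trans ?_
  rw [EuclideanSpace.volume_closedBall_fin_two, mul_comm (4 : ℝ),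
    ENNReal.ofReal_mul (by positivity), ENNReal.ofReal_pow Metric.diam_nonneg]
  gcongr
  exact Real.pi_le_four

theorem IsPolygonalElement.diam_pos {n : ℕ} {P : Polygon Plane n} {K : Set Plane}
    (hP : IsPolygonalElement P K) : 0 < Metric.diam K := by
  obtain ⟨x, hx⟩ := hP.isConnected.nonempty
  obtain ⟨ε, hε, hb⟩ := Metric.isOpen_iff.1 hP.isOpen x hx
  refine Metric.diam_pos ⟨x, hx, x + EuclideanSpace.single 0 (ε / 2), hb ?_, ?_⟩ hP.isBounded
  · rw [Metric.mem_ball, dist_eq_norm, add_sub_cancel_left]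
    simp [abs_of_pos hε, hε]
  · intro h
    have := congrArg (fun y : Plane => y 0) h
    simp at this
    exact hε.ne' this

/-- Cauchy-Schwarz, with the square root of the area bounded by twice the diameter. -/
theorem lintegral_enorm_le_diam_mul_eLpNorm {F : Type*} [NormedAddCommGroup F] {K : Set Plane}
    (hK : Bornology.IsBounded K) {f : Plane → F}
    (hf : AEStronglyMeasurable f (volume.restrict K)) :
    ∫⁻ x in K, ‖f x‖ₑ ≤ ENNReal.ofReal (2 * Metric.diam K) * eLpNorm f 2 (volume.restrict K) := by
  rw [← eLpNorm_one_eq_lintegral_enorm, mul_comm]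
  refine (eLpNorm_le_eLpNorm_mul_rpow_measure_univ one_le_two hf).trans ?_
  gcongr
  rw [Measure.restrict_apply_univ]
  refine (ENNReal.rpow_le_rpow (volume_le_ofReal_diam_sq hK) (by norm_num)).trans (le_of_eq ?_)
  have h4 : 4 * Metric.diam K ^ 2 = (2 * Metric.diam K) ^ (2 : ℝ) := by
    rw [Real.rpow_two]; ring
  have hd : 0 ≤ 2 * Metric.diam K := by linarith [Metric.diam_nonneg (s := K)]
  rw [h4, ← ENNReal.ofReal_rpow_of_nonneg hd zero_le_two, ← ENNReal.rpow_mul]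
  norm_num

/-- The constant in the comparison of mean values on a shape regular polygon and on a part of its
boundary. -/
def averageConst (γ₀ γ₁ : ℝ) : ℝ := 2 * (32 / γ₀ ^ 4 + (64 / γ₀ ^ 2 + 1) / (γ₀ * γ₁))

theorem averageConst_nonneg {γ₀ γ₁ : ℝ} (h₀ : 0 < γ₀) (h₁ : 0 < γ₁) :
    0 ≤ averageConst γ₀ γ₁ := by
  unfold averageConst; positivity

theorem IsPolygonalElement.enorm_average_sub_average_le {γ₀ γ₁ : ℝ} (h₀ : 0 < γ₀) (h₁ : 0 < γ₁)
    {n : ℕ} {P : Polygon Plane n} {K : Set Plane} (hP : IsPolygonalElement P K)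
    (hreg : IsShapeRegular γ₀ γ₁ P K) {τ : Set Plane} (hτ : τ ⊆ frontier K)
    (hτl : γ₁ * Metric.diam K ≤ arcLength.real τ) {φ : Plane → ℝ} (hφ : ContDiff ℝ 1 φ) :
    ‖(⨍ x in τ, φ x ∂arcLength) - ⨍ x in K, φ x‖ₑ ≤
      ENNReal.ofReal (averageConst γ₀ γ₁) * eLpNorm (fderiv ℝ φ) 2 (volume.restrict K) := by
  obtain ⟨c, r, hrγ, hB, hs⟩ := hreg.starShaped
  have hh := hP.diam_pos
  have hKb := hP.isBounded
  set h := Metric.diam K with hhdef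
  have hr : 0 < r := lt_of_lt_of_le (by positivity) hrγ
  have hf' : Continuous (fderiv ℝ φ) := hφ.continuous_fderiv one_ne_zero
  have hφc := hφ.continuous
  set B := Metric.ball c r with hBdef
  set κ := volume K with hκ
  set β := volume B with hβ
  set I := ∫⁻ x in K, ‖fderiv ℝ φ x‖ₑ with hI
  have hκtop : κ < ⊤ := hKb.measure_lt_top
  have hβtop : β < ⊤ := Metric.isBounded_ball.measure_lt_top
  have hβκ : β ≤ κ := measure_mono hB
  have hβlow : ENNReal.ofReal ((γ₀ * h) ^ 2) ≤ β :=
    (ENNReal.ofReal_le_ofReal (pow_le_pow_left₀ (by positivity) hrγ 2)).trans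
      (ofReal_sq_le_volume_ball c hr.le)
  have hβ0 : 0 < β := lt_of_lt_of_le (by rw [ENNReal.ofReal_pos]; positivity) hβlow
  have hβinv : β⁻¹ ≤ ENNReal.ofReal ((γ₀ * h) ^ 2)⁻¹ := by
    rw [ENNReal.ofReal_inv_of_pos (by positivity)]
    exact ENNReal.inv_le_inv.2 hβlow
  have hκup : κ ≤ ENNReal.ofReal (4 * h ^ 2) := volume_le_ofReal_diam_sq hKb
  have hintB : ∀ {A : Set Plane}, Bornology.IsBounded A → IntegrableOn φ A := fun hA =>
    (hφc.continuousOn.integrableOn_compact hA.isCompact_closure).mono_set subset_closure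
  -- The mean over the ball is the intermediate value with which both other means are compared.
  set a := ⨍ y in B, φ y with ha
  have hfinB : IsFiniteMeasure (volume.restrict B) := ⟨by simpa using hβtop⟩
  have hfinK : IsFiniteMeasure (volume.restrict K) := ⟨by simpa using hκtop⟩
  have hfrtop := hP.arcLength_frontier_lt_top
  have hτtop : arcLength τ < ⊤ := (measure_mono hτ).trans_lt hfrtop
  have hfinτ : IsFiniteMeasure (arcLength.restrict τ) := ⟨by simpa using hτtop⟩
  -- the mean deviation on `K`
  have hX : ∫⁻ x in K, ‖φ x - a‖ₑ ≤ ENNReal.ofReal (32 * h / γ₀ ^ 2) * I := by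
    calc ∫⁻ x in K, ‖φ x - a‖ₑ ≤ ∫⁻ x in K, β⁻¹ * ∫⁻ y in B, ‖φ x - φ y‖ₑ := by
          refine lintegral_mono fun x => ?_
          have := enorm_average_sub_le (μ := volume.restrict B)
            (by rw [Ne, Measure.restrict_eq_zero]; exact hβ0.ne')
            (hintB Metric.isBounded_ball) (φ x)
          rw [Measure.restrict_apply_univ] at this
          rw [enorm_sub_rev]
          refine this.trans (le_of_eq ?_)
          congr 1
          exact lintegral_congr fun y => enorm_sub_rev _ _
      _ = β⁻¹ * ∫⁻ x in K, ∫⁻ y in B, ‖φ x - φ y‖ₑ :=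
          lintegral_const_mul' _ _ (ENNReal.inv_ne_top.2 hβ0.ne')
      _ ≤ β⁻¹ * (ENNReal.ofReal h * (4 * (κ + β) * I)) := by
          gcongr
          exact lintegral_lintegral_enorm_sub_le hP.isOpen hKb hB hs hφ
      -- Both areas are at most `4 h²` and `β` is at least `(γ₀ h)²`, so the constant is `h · 4 ·
      -- 8h² / (γ₀ h)² = 32 h / γ₀²`.
      _ ≤ ENNReal.ofReal ((γ₀ * h) ^ 2)⁻¹ * (ENNReal.ofReal h *
            (ENNReal.ofReal 4 *
              (ENNReal.ofReal (4 * h ^ 2) + ENNReal.ofReal (4 * h ^ 2)) * I)) := by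
          rw [ENNReal.ofReal_ofNat]
          gcongr
          exact hβκ.trans hκup
      _ = ENNReal.ofReal (32 * h / γ₀ ^ 2) * I := by
          rw [← ENNReal.ofReal_add (by positivity) (by positivity),
            ← ENNReal.ofReal_mul (by positivity), ← mul_assoc, ← mul_assoc,
            ← ENNReal.ofReal_mul (by positivity), ← ENNReal.ofReal_mul (by positivity)]
          congr 2
          field_simp
          ring
  have hKavg : ‖(⨍ x in K, φ x) - a‖ₑ ≤ ENNReal.ofReal (32 / (γ₀ ^ 4 * h)) * I := by
    have := enorm_average_sub_le (μ := volume.restrict K)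
      (by rw [Ne, Measure.restrict_eq_zero]; exact (hβ0.trans_le hβκ).ne') (hintB hKb) a
    rw [Measure.restrict_apply_univ] at this
    refine this.trans ?_
    calc κ⁻¹ * ∫⁻ x in K, ‖φ x - a‖ₑ
        ≤ ENNReal.ofReal ((γ₀ * h) ^ 2)⁻¹ * (ENNReal.ofReal (32 * h / γ₀ ^ 2) * I) := by
          gcongr
          exact (ENNReal.inv_le_inv.2 hβκ).trans hβinv
      _ = _ := by
          rw [← mul_assoc, ← ENNReal.ofReal_mul (by positivity)]
          congr 2
          field_simp
  have hτpos : ENNReal.ofReal (γ₁ * h) ≤ arcLength τ := by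
    rw [ENNReal.ofReal_le_iff_le_toReal hτtop.ne]
    exact hτl
  have hτ0 : arcLength τ ≠ 0 :=
    (lt_of_lt_of_le (by rw [ENNReal.ofReal_pos]; positivity) hτpos).ne'
  -- The trace inequality is applied to `φ - a`: its zeroth-order term contributes `2 · 32 h / γ₀²`
  -- by `hX`, its gradient term contributes `h`.
  have hfr : ENNReal.ofReal (γ₀ * h) * ∫⁻ x in τ, ‖φ x - a‖ₑ ∂arcLength ≤
      ENNReal.ofReal (64 * h / γ₀ ^ 2 + h) * I := by
    have htr := hP.lintegral_frontier_le hr hB hs (ψ := fun x => φ x - a) (hφ.sub contDiff_const)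
    simp only [fderiv_sub_const] at htr
    have hm : Measurable fun x => 2 * ‖φ x - a‖ₑ :=
      ((hφc.sub continuous_const).measurable.enorm).const_mul _
    rw [lintegral_add_left hm, lintegral_const_mul' _ _ ENNReal.ofNat_ne_top,
      lintegral_const_mul' _ _ ENNReal.ofReal_ne_top] at htr
    calc _ ≤ ENNReal.ofReal r * ∫⁻ x in frontier K, ‖φ x - a‖ₑ ∂arcLength := by
          gcongr
      _ ≤ _ := htr
      _ ≤ ENNReal.ofReal 2 * (ENNReal.ofReal (32 * h / γ₀ ^ 2) * I) + ENNReal.ofReal h * I := by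
          rw [ENNReal.ofReal_ofNat]
          gcongr
      _ = _ := by
          rw [← mul_assoc, ← ENNReal.ofReal_mul (by positivity), ← add_mul,
            ← ENNReal.ofReal_add (by positivity) (by positivity)]
          congr 3
          ring
  have hτavg : ‖(⨍ x in τ, φ x ∂arcLength) - a‖ₑ ≤
      ENNReal.ofReal ((64 / γ₀ ^ 2 + 1) / (γ₀ * γ₁ * h)) * I := by
    have hint : Integrable φ (arcLength.restrict τ) := by
      have hKc : IsCompact (frontier K) :=
        Metric.isCompact_of_isClosed_isBounded isClosed_frontier
          (hKb.closure.subset frontier_subset_closure)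
      exact (hφc.continuousOn.integrableOn_of_subset_isCompact hKc
        isClosed_frontier.measurableSet subset_rfl hfrtop.ne).mono_set hτ
    have := enorm_average_sub_le (μ := arcLength.restrict τ)
      (by rw [Ne, Measure.restrict_eq_zero]; exact hτ0) hint a
    rw [Measure.restrict_apply_univ] at this
    refine this.trans ?_
    have hg0 : ENNReal.ofReal (γ₀ * h) ≠ 0 := by
      rw [Ne, ENNReal.ofReal_eq_zero, not_le]; positivity
    rw [ENNReal.mul_le_iff_le_inv hg0 ENNReal.ofReal_ne_top,
      ← ENNReal.ofReal_inv_of_pos (by positivity)] at hfr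
    calc (arcLength τ)⁻¹ * ∫⁻ x in τ, ‖φ x - a‖ₑ ∂arcLength
        ≤ ENNReal.ofReal (γ₁ * h)⁻¹ *
          (ENNReal.ofReal (γ₀ * h)⁻¹ * (ENNReal.ofReal (64 * h / γ₀ ^ 2 + h) * I)) := by
          rw [ENNReal.ofReal_inv_of_pos (x := γ₁ * h) (by positivity)]
          gcongr
      _ = _ := by
          rw [← mul_assoc, ← mul_assoc, ← ENNReal.ofReal_mul (by positivity),
            ← ENNReal.ofReal_mul (by positivity)]
          congr 2
          field_simp
  -- Both mean estimates carry a factor `1 / h`. The factor `2 h` gained here cancels it and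
  -- accounts for the leading `2` in `averageConst`.
  have hIN := lintegral_enorm_le_diam_mul_eLpNorm hKb hf'.aestronglyMeasurable
    (f := fderiv ℝ φ)
  calc ‖(⨍ x in τ, φ x ∂arcLength) - ⨍ x in K, φ x‖ₑ
      ≤ ‖(⨍ x in τ, φ x ∂arcLength) - a‖ₑ + ‖(⨍ x in K, φ x) - a‖ₑ := by
        rw [← sub_sub_sub_cancel_right _ _ a]
        exact enorm_sub_le
    _ ≤ ENNReal.ofReal ((64 / γ₀ ^ 2 + 1) / (γ₀ * γ₁ * h)) * I +
          ENNReal.ofReal (32 / (γ₀ ^ 4 * h)) * I := add_le_add hτavg hKavg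
    _ ≤ ENNReal.ofReal ((64 / γ₀ ^ 2 + 1) / (γ₀ * γ₁ * h) + 32 / (γ₀ ^ 4 * h)) *
          (ENNReal.ofReal (2 * h) * eLpNorm (fderiv ℝ φ) 2 (volume.restrict K)) := by
        rw [← add_mul, ← ENNReal.ofReal_add (by positivity) (by positivity)]
        gcongr
    _ = _ := by
        rw [← mul_assoc, ← ENNReal.ofReal_mul (by positivity), averageConst]
        congr 2
        field_simp
        ring

/-! ### Mollification and continuity of dilations and translations in `L²` -/

theorem eLpNorm_two_sq {α F : Type*} [MeasurableSpace α] [NormedAddCommGroup F] (μ : Measure α)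
    (f : α → F) : eLpNorm f 2 μ ^ 2 = ∫⁻ x, ‖f x‖ₑ ^ 2 ∂μ := by
  have := eLpNorm_nnreal_pow_eq_lintegral (f := f) (μ := μ) (p := 2) two_ne_zero
  simpa using this

section Mollification

variable {V : Type*} [NormedAddCommGroup V]

theorem eLpNorm_comp_smul_add {a : ℝ} (ha : 0 < a) (z : Plane) (f : Plane → V) :
    eLpNorm (fun x => f (a • x + z)) 2 volume = ENNReal.ofReal a⁻¹ * eLpNorm f 2 volume := by
  have h2 : Function.Injective fun x : ℝ≥0∞ => x ^ 2 := fun x y h =>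
    le_antisymm ((ENNReal.pow_le_pow_left_iff two_ne_zero).1 h.le)
      ((ENNReal.pow_le_pow_left_iff two_ne_zero).1 h.ge)
  refine h2 ?_
  simp only
  rw [mul_pow, eLpNorm_two_sq, eLpNorm_two_sq,
    lintegral_comp_smul_add ha.ne' z (fun x => ‖f x‖ₑ ^ 2), ← ENNReal.ofReal_pow (by positivity),
    inv_pow]

/-- Continuity in `L²` of dilations and translations. -/
theorem MeasureTheory.MemLp.exists_eLpNorm_comp_smul_add_sub_le {F : Plane → V} [NormedSpace ℝ V]
    (hF : MemLp F 2 volume) {ε : ℝ≥0∞} (hε : ε ≠ 0) :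
    ∃ δ : ℝ, 0 < δ ∧ ∀ (t : ℝ) (z : Plane), |t - 1| < δ → ‖z‖ < δ →
      eLpNorm (fun x => F (t • x + z) - F x) 2 volume ≤ ε := by
  obtain ⟨f, hfs, hFf, hfc, hfm⟩ := hF.exists_hasCompactSupport_eLpNorm_sub_le
    ENNReal.ofNat_ne_top (ε := ε / 4) (ENNReal.div_ne_zero.2 ⟨hε, ENNReal.ofNat_ne_top⟩)
  obtain ⟨R, hR0, hR⟩ := hfs.isCompact.isBounded.exists_pos_norm_le
  have huc : UniformContinuous f := hfs.uniformContinuous_of_continuous hfc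
  -- The radius is such that `‖x‖ > 2R + 2`, `t > 1/2` and `‖z‖ < 1/2` force `‖t • x + z‖ > R`, so
  -- that both `f x` and `f (t • x + z)` vanish.
  set S : Set Plane := Metric.closedBall 0 (2 * R + 2) with hS
  have hSfin : volume S ≠ ⊤ := Metric.isBounded_closedBall.measure_lt_top.ne
  obtain ⟨η, hη0, hη⟩ : ∃ η : ℝ, 0 < η ∧
      volume S ^ (2 : ℝ≥0∞).toReal⁻¹ * ENNReal.ofReal η ≤ ε / 4 := by
    have hfin : volume S ^ (2 : ℝ≥0∞).toReal⁻¹ ≠ ⊤ := by finiteness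
    have hlim : Tendsto (fun η : ℝ => volume S ^ (2 : ℝ≥0∞).toReal⁻¹ * ENNReal.ofReal η)
        (𝓝[>] 0) (𝓝 0) := by
      have h1 : Tendsto (fun η : ℝ => ENNReal.ofReal η) (𝓝[>] 0) (𝓝 0) := by
        simpa using (ENNReal.continuous_ofReal.tendsto 0).mono_left nhdsWithin_le_nhds
      simpa using ENNReal.Tendsto.const_mul h1 (Or.inr hfin)
    have h4 : (0 : ℝ≥0∞) < ε / 4 := pos_iff_ne_zero.2
      (ENNReal.div_ne_zero.2 ⟨hε, ENNReal.ofNat_ne_top⟩)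
    obtain ⟨η, h1, h2⟩ := ((hlim.eventually (gt_mem_nhds h4)).and self_mem_nhdsWithin).exists
    exact ⟨η, h2, h1.le⟩
  obtain ⟨δ', hδ'0, hδ'⟩ := Metric.uniformContinuous_iff.1 huc η hη0
  -- On `S` the displacement is at most `|t - 1| (2R + 2) + ‖z‖`, which the second bound makes
  -- smaller than `δ'`.
  refine ⟨min (1 / 2) (δ' / (2 * R + 3)), by positivity, fun t z ht hz => ?_⟩
  have ht1 : |t - 1| < 1 / 2 := ht.trans_le (min_le_left _ _)
  have ht2 : |t - 1| < δ' / (2 * R + 3) := ht.trans_le (min_le_right _ _)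
  have hz1 : ‖z‖ < 1 / 2 := hz.trans_le (min_le_left _ _)
  have hz2 : ‖z‖ < δ' / (2 * R + 3) := hz.trans_le (min_le_right _ _)
  have htl : 1 / 2 < t := by linarith [(abs_lt.1 ht1).1]
  have hsupp : Function.support (fun x => f (t • x + z) - f x) ⊆ S := by
    intro x hx
    by_contra hxS
    rw [hS, mem_closedBall_zero_iff, not_le] at hxS
    have h0 : ∀ y : Plane, R < ‖y‖ → f y = 0 := fun y hy =>
      image_eq_zero_of_notMem_tsupport fun hc => (hR y hc).not_gt hy
    refine hx ?_
    have h1 : R < ‖t • x + z‖ := by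
      have e : t • x = (t • x + z) - z := by abel
      have h2 : ‖t • x‖ ≤ ‖t • x + z‖ + ‖z‖ := by
        conv_lhs => rw [e]
        exact norm_sub_le _ _
      rw [norm_smul, Real.norm_eq_abs, abs_of_pos (by linarith)] at h2
      nlinarith
    show f (t • x + z) - f x = 0
    rw [h0 _ h1, h0 x (by linarith), sub_zero]
  have hmid : eLpNorm (fun x => f (t • x + z) - f x) 2 volume ≤ ε / 4 := by
    rw [← eLpNorm_restrict_eq_of_support_subset hsupp]
    refine (eLpNorm_le_of_ae_bound (C := η) ?_).trans ?_
    · refine (ae_restrict_iff' measurableSet_closedBall).2 (.of_forall fun x hx => ?_)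
      rw [← dist_eq_norm]
      refine (hδ' ?_).le
      rw [dist_eq_norm]
      have e : t • x + z - x = (t - 1) • x + z := by module
      rw [e]
      rw [mem_closedBall_zero_iff] at hx
      calc ‖(t - 1) • x + z‖ ≤ |t - 1| * ‖x‖ + ‖z‖ := by
            refine (norm_add_le _ _).trans ?_
            rw [norm_smul, Real.norm_eq_abs]
        _ ≤ |t - 1| * (2 * R + 2) + ‖z‖ := by gcongr
        _ < δ' / (2 * R + 3) * (2 * R + 2) + δ' / (2 * R + 3) := by gcongr
        _ = δ' := by field_simp; ring
    · rw [Measure.restrict_apply_univ]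
      exact hη
  have hA : Measure.QuasiMeasurePreserving (fun x : Plane => t • x + z) volume volume := by
    have h1 : Measure.QuasiMeasurePreserving (fun x : Plane => t • x) volume volume := by
      refine ⟨measurable_const_smul t, ?_⟩
      rw [Measure.map_addHaar_smul volume (by linarith : t ≠ 0)]
      exact Measure.smul_absolutelyContinuous
    exact (measurePreserving_add_right volume z).quasiMeasurePreserving.comp h1
  have hFA : AEStronglyMeasurable (fun x => F (t • x + z)) volume :=
    hF.aestronglyMeasurable.comp_quasiMeasurePreserving hA
  have hfA : AEStronglyMeasurable (fun x => f (t • x + z)) volume :=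
    hfc.aestronglyMeasurable.comp_quasiMeasurePreserving hA
  -- Dilating by `t > 1/2` in the plane multiplies `L²` norms by `t⁻¹ ≤ 2`, hence two of the four
  -- quarters of `ε`.
  have hfirst : eLpNorm (fun x => F (t • x + z) - f (t • x + z)) 2 volume ≤ 2 * (ε / 4) := by
    rw [eLpNorm_comp_smul_add (by linarith) z (fun x => F x - f x)]
    refine mul_le_mul' (ENNReal.ofReal_le_of_le_toReal ?_) hFf
    rw [ENNReal.toReal_ofNat, inv_le_comm₀ (by linarith) (by norm_num)]
    linarith
  calc eLpNorm (fun x => F (t • x + z) - F x) 2 volume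
      = eLpNorm ((fun x => F (t • x + z) - f (t • x + z)) +
          ((fun x => f (t • x + z) - f x) - (F - f))) 2 volume := by
        congr 1
        ext1 x
        simp only [Pi.add_apply, Pi.sub_apply]
        abel
    _ ≤ 2 * (ε / 4) + (ε / 4 + ε / 4) := by
        refine (eLpNorm_add_le (hFA.sub hfA) ((hfA.sub hfc.aestronglyMeasurable).sub
          (hF.aestronglyMeasurable.sub hfc.aestronglyMeasurable)) one_le_two).trans ?_
        refine add_le_add hfirst ?_
        exact (eLpNorm_sub_le (hfA.sub hfc.aestronglyMeasurable)
          (hF.aestronglyMeasurable.sub hfc.aestronglyMeasurable) one_le_two).trans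
          (add_le_add hmid hFf)
    _ = 4 * (ε / 4) := by ring
    _ = ε := ENNReal.mul_div_cancel (by norm_num) (by norm_num)

variable [NormedSpace ℝ V]

/-- Mollification of a function on the plane with a normalised bump function. -/
def mollify (ζ : ContDiffBump (0 : Plane)) (F : Plane → V) (w : Plane) : V :=
  ∫ s, ζ.normed volume s • F (w - s)

theorem mollify_eq_integral_sub (ζ : ContDiffBump (0 : Plane)) (F : Plane → V) (w : Plane) :
    mollify ζ F w = ∫ y, ζ.normed volume (w - y) • F y := by
  rw [mollify, ← integral_sub_left_eq_self (fun y => ζ.normed volume (w - y) • F y) volume w]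
  simp only [sub_sub_cancel]

theorem integrable_normed_smul_comp_sub (ζ : ContDiffBump (0 : Plane)) {F : Plane → V}
    (hF : LocallyIntegrable F volume) (w : Plane) :
    Integrable (fun s => ζ.normed volume s • F (w - s)) :=
  (ζ.hasCompactSupport_normed.convolutionExists_left (ContinuousLinearMap.lsmul ℝ ℝ)
    ζ.continuous_normed hF w)

/-- Jensen's inequality for the probability measure whose density is the normalised bump. -/
theorem enorm_sq_integral_smul_le (ζ : ContDiffBump (0 : Plane)) {f : Plane → V}
    (hf : StronglyMeasurable f) :
    ‖∫ s, ζ.normed volume s • f s‖ₑ ^ 2 ≤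
      ∫⁻ s, ENNReal.ofReal (ζ.normed volume s) * ‖f s‖ₑ ^ 2 := by
  set ρ : Plane → ℝ≥0∞ := fun s => ENNReal.ofReal (ζ.normed volume s) with hρ
  have hρm : Measurable ρ := ζ.continuous_normed.measurable.ennreal_ofReal
  set ν := (volume : Measure Plane).withDensity ρ with hν
  have hν1 : ν univ = 1 := by
    rw [hν, withDensity_apply _ MeasurableSet.univ, Measure.restrict_univ,
      ← ofReal_integral_eq_lintegral_ofReal ζ.integrable_normed (.of_forall ζ.nonneg_normed),
      ζ.integral_normed, ENNReal.ofReal_one]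
  have : IsProbabilityMeasure ν := ⟨hν1⟩
  have h1 : ‖∫ s, ζ.normed volume s • f s‖ₑ ≤ ∫⁻ s, ‖f s‖ₑ ∂ν := by
    rw [hν, lintegral_withDensity_eq_lintegral_mul _ hρm hf.enorm]
    refine (enorm_integral_le_lintegral_enorm _).trans (lintegral_mono fun s => ?_)
    rw [enorm_smul, Pi.mul_apply, hρ, Real.enorm_of_nonneg (ζ.nonneg_normed s)]
  have h2 : ∫⁻ s, ‖f s‖ₑ ∂ν ≤ eLpNorm f 2 ν := by
    rw [← eLpNorm_one_eq_lintegral_enorm]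
    exact eLpNorm_le_eLpNorm_of_exponent_le one_le_two hf.aestronglyMeasurable
  refine (pow_le_pow_left' (h1.trans h2) 2).trans (le_of_eq ?_)
  rw [eLpNorm_two_sq, hν, lintegral_withDensity_eq_lintegral_mul _ hρm (hf.enorm.pow_const 2)]
  rfl

theorem mollify_sub_eq [CompleteSpace V] (ζ : ContDiffBump (0 : Plane)) {F : Plane → V}
    (hF : LocallyIntegrable F volume) (w : Plane) (v : V) :
    mollify ζ F w - v = ∫ s, ζ.normed volume s • (F (w - s) - v) := by
  simp only [smul_sub]
  rw [integral_sub (integrable_normed_smul_comp_sub ζ hF _)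
    (ζ.integrable_normed.smul_const _), integral_smul_const, ζ.integral_normed, one_smul, mollify]

/-- A mollification is an average of translates by vectors in the support of the bump, so by Jensen
and Tonelli its `L²` error is at most a uniform bound for the errors of these translates. -/
theorem eLpNorm_mollify_comp_sub_le [CompleteSpace V] (ζ : ContDiffBump (0 : Plane))
    {F : Plane → V} (hFm : StronglyMeasurable F) (hF : LocallyIntegrable F volume)
    {t : ℝ} {z : Plane} {ε : ℝ≥0∞}
    (h : ∀ w ∈ Metric.ball (0 : Plane) ζ.rOut,
      eLpNorm (fun x => F (t • x + (z - w)) - F x) 2 volume ≤ ε) :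
    eLpNorm (fun x => mollify ζ F (t • x + z) - F x) 2 volume ≤ ε := by
  have hc1 : Continuous fun p : Plane × Plane => t • p.1 + z - p.2 := by fun_prop
  have hm1 : StronglyMeasurable fun p : Plane × Plane => F (t • p.1 + z - p.2) :=
    hFm.comp_measurable hc1.measurable
  have hm2 : StronglyMeasurable fun p : Plane × Plane => F p.1 :=
    hFm.comp_measurable measurable_fst
  have hsm : ∀ x, StronglyMeasurable fun s => F (t • x + z - s) - F x := fun x => by
    have h1 : StronglyMeasurable fun s => F (t • x + z - s) :=
      hFm.comp_measurable (measurable_const.sub measurable_id)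
    exact h1.sub stronglyMeasurable_const
  have hρm : Measurable fun s => ENNReal.ofReal (ζ.normed volume s) :=
    ζ.continuous_normed.measurable.ennreal_ofReal
  have hjm : Measurable (Function.uncurry fun x s : Plane =>
      ENNReal.ofReal (ζ.normed volume s) * ‖F (t • x + z - s) - F x‖ₑ ^ 2) :=
    (hρm.comp measurable_snd).mul ((hm1.sub hm2).enorm.pow_const 2)
  rw [← ENNReal.pow_le_pow_left_iff two_ne_zero, eLpNorm_two_sq]
  calc ∫⁻ x, ‖mollify ζ F (t • x + z) - F x‖ₑ ^ 2
      ≤ ∫⁻ x, ∫⁻ s, ENNReal.ofReal (ζ.normed volume s) * ‖F (t • x + z - s) - F x‖ₑ ^ 2 := by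
        refine lintegral_mono fun x => ?_
        rw [mollify_sub_eq ζ hF]
        exact enorm_sq_integral_smul_le ζ (hsm x)
    _ = ∫⁻ s, ∫⁻ x, ENNReal.ofReal (ζ.normed volume s) * ‖F (t • x + z - s) - F x‖ₑ ^ 2 :=
        lintegral_lintegral_swap hjm.aemeasurable
    _ ≤ ∫⁻ s, ENNReal.ofReal (ζ.normed volume s) * ε ^ 2 := by
        refine lintegral_mono fun s => ?_
        rw [lintegral_const_mul' _ _ ENNReal.ofReal_ne_top]
        by_cases hs : s ∈ Metric.ball (0 : Plane) ζ.rOut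
        · refine mul_le_mul_right ?_ _
          rw [← eLpNorm_two_sq (volume : Measure Plane) (fun x => F (t • x + z - s) - F x)]
          refine pow_le_pow_left' ?_ 2
          simpa only [add_sub_assoc] using h s hs
        · rw [← ζ.support_normed_eq (μ := volume), Function.notMem_support] at hs
          simp [hs]
    _ = ε ^ 2 := by
        rw [lintegral_mul_const _ hρm,
          ← ofReal_integral_eq_lintegral_ofReal ζ.integrable_normed (.of_forall ζ.nonneg_normed),
          ζ.integral_normed, ENNReal.ofReal_one, one_mul]

end Mollification

section MollifySmooth

variable {u : Plane → ℝ}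

theorem mollify_eq_convolution (ζ : ContDiffBump (0 : Plane)) (u : Plane → ℝ) :
    mollify ζ u = MeasureTheory.convolution u (ζ.normed volume) (ContinuousLinearMap.mul ℝ ℝ)
      volume := by
  ext w
  rw [mollify_eq_integral_sub, convolution_def]
  simp only [smul_eq_mul, ContinuousLinearMap.mul_apply', mul_comm]

theorem contDiff_mollify (ζ : ContDiffBump (0 : Plane)) (hu : LocallyIntegrable u volume) :
    ContDiff ℝ ∞ (mollify ζ u) := by
  rw [mollify_eq_convolution]
  exact ζ.hasCompactSupport_normed.contDiff_convolution_right _ hu ζ.contDiff_normed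

theorem continuous_mollify {V : Type*} [NormedAddCommGroup V] [NormedSpace ℝ V]
    (ζ : ContDiffBump (0 : Plane)) {F : Plane → V} (hF : LocallyIntegrable F volume) :
    Continuous (mollify ζ F) :=
  ζ.hasCompactSupport_normed.continuous_convolution_left (ContinuousLinearMap.lsmul ℝ ℝ)
    ζ.continuous_normed hF

theorem fderiv_mollify_apply (ζ : ContDiffBump (0 : Plane)) (hu : LocallyIntegrable u volume)
    (w e : Plane) :
    fderiv ℝ (mollify ζ u) w e = ∫ y, u y * fderiv ℝ (ζ.normed volume) (w - y) e := by
  have hc : ContDiff ℝ 1 (ζ.normed volume) := ζ.contDiff_normed (n := 1)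
  have h := ζ.hasCompactSupport_normed.hasFDerivAt_convolution_right
    (ContinuousLinearMap.mul ℝ ℝ) hu hc w
  rw [mollify_eq_convolution, h.fderiv, convolution_precompR_apply _ hu
    (ζ.hasCompactSupport_normed.fderiv ℝ) (hc.continuous_fderiv one_ne_zero), convolution_def]
  simp only [ContinuousLinearMap.mul_apply']

end MollifySmooth

/-! ### Density of smooth functions in `H¹(K)` -/

theorem fderiv_comp_const_sub_apply {f : Plane → ℝ} (hf : Differentiable ℝ f) (w y e : Plane) :
    fderiv ℝ (fun y => f (w - y)) y e = -fderiv ℝ f (w - y) e := by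
  have h1 : HasFDerivAt (fun y : Plane => w - y) (-ContinuousLinearMap.id ℝ Plane) y :=
    (hasFDerivAt_id y).const_sub w
  have h2 := (hf (w - y)).hasFDerivAt.comp y h1
  have h3 : fderiv ℝ (fun y => f (w - y)) y = _ := h2.fderiv
  rw [h3]
  simp

/-- The gradient of the mollification of an `H¹` function is the mollification of its weak
gradient, at points whose distance to the complement is large enough. -/
theorem IsH1WithGradient.gradient_mollify {K : Set Plane} {u : Plane → ℝ} {G : Plane → Plane}
    (hK : IsOpen K) (h : IsH1WithGradient K u G) {u₀ : Plane → ℝ} {G₀ : Plane → Plane}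
    (hu : LocallyIntegrable u₀ volume) (hG : LocallyIntegrable G₀ volume)
    (hu₀ : u₀ =ᵐ[volume] K.indicator u) (hG₀ : G₀ =ᵐ[volume] K.indicator G)
    (ζ : ContDiffBump (0 : Plane)) {w : Plane} (hw : ∀ v : Plane, ‖v‖ ≤ ζ.rOut → w - v ∈ K) :
    ∇ (mollify ζ u₀) w = mollify ζ G₀ w := by
  have hmK := hK.measurableSet
  have hcd : ContDiff ℝ ∞ (ζ.normed volume) := ζ.contDiff_normed
  refine ext_inner_right ℝ fun e => ?_
  rw [gradient, InnerProductSpace.toDual_symm_apply, fderiv_mollify_apply ζ hu]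
  have hη : ContDiff ℝ ∞ fun y => ζ.normed volume (w - y) := hcd.comp (by fun_prop)
  have hηsupp : tsupport (fun y => ζ.normed volume (w - y)) ⊆ Metric.closedBall w ζ.rOut := by
    refine closure_minimal (fun y hy => ?_) Metric.isClosed_closedBall
    have hy' : w - y ∈ Function.support (ζ.normed volume) := hy
    rw [ζ.support_normed_eq, mem_ball_zero_iff] at hy'
    rw [Metric.mem_closedBall, dist_comm, dist_eq_norm]
    exact hy'.le
  have hball : Metric.closedBall w ζ.rOut ⊆ K := fun y hy => by
    rw [Metric.mem_closedBall, dist_comm, dist_eq_norm] at hy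
    simpa using hw (w - y) hy
  have hηc : HasCompactSupport fun y => ζ.normed volume (w - y) :=
    HasCompactSupport.of_support_subset_isCompact (isCompact_closedBall w ζ.rOut)
      (subset_closure.trans hηsupp)
  -- The translated reflected bump is an admissible test function because `hw` keeps its support in
  -- `K`. The sign from differentiating `w - y` cancels the sign in the definition of the weak
  -- gradient.
  have key := h.integral_by_parts _ hη hηc (hηsupp.trans hball) e
  simp only [fderiv_comp_const_sub_apply (hcd.differentiable (by simp)), mul_neg,
    integral_neg, neg_inj] at key
  have e1 : ∫ y, u₀ y * fderiv ℝ (ζ.normed volume) (w - y) e =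
      ∫ y in K, u y * fderiv ℝ (ζ.normed volume) (w - y) e := by
    rw [← integral_indicator hmK]
    refine integral_congr_ae ?_
    filter_upwards [hu₀] with y hy
    rw [hy, indicator_mul_left]
  have e2 : inner ℝ (mollify ζ G₀ w) e =
      ∫ y in K, inner ℝ (G y) e * ζ.normed volume (w - y) := by
    have hint : Integrable fun y => ζ.normed volume (w - y) • G₀ y := by
      have := (integrable_normed_smul_comp_sub ζ hG w).comp_sub_left w
      simpa only [sub_sub_cancel] using this
    rw [mollify_eq_integral_sub, real_inner_comm, ← integral_inner hint,
      ← integral_indicator hmK]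
    refine integral_congr_ae ?_
    filter_upwards [hG₀] with y hy
    rw [hy]
    by_cases hyK : y ∈ K
    · rw [indicator_of_mem hyK, indicator_of_mem hyK, inner_smul_right, real_inner_comm, mul_comm]
    · rw [indicator_of_notMem hyK, indicator_of_notMem hyK, smul_zero, inner_zero_right]
  rw [e1, e2, key]

theorem gradient_comp_smul_add {f : Plane → ℝ} (hf : Differentiable ℝ f) (t : ℝ) (z x : Plane) :
    ∇ (fun x => f (t • x + z)) x = t • ∇ f (t • x + z) := by
  have h1 : HasFDerivAt (fun x : Plane => t • x + z) (t • ContinuousLinearMap.id ℝ Plane) x :=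
    ((hasFDerivAt_id x).const_smul t).add_const z
  have h2 := (hf (t • x + z)).hasFDerivAt.comp x h1
  have h3 : fderiv ℝ (fun x => f (t • x + z)) x = _ := h2.fderiv
  refine ext_inner_right ℝ fun e => ?_
  rw [inner_smul_left, gradient, gradient, InnerProductSpace.toDual_symm_apply,
    InnerProductSpace.toDual_symm_apply, h3]
  simp

/-- The extension by zero is replaced by a strongly measurable representative, so that integrands in
two variables are jointly measurable in the Tonelli arguments. -/
theorem exists_stronglyMeasurable_indicator {V : Type*} [NormedAddCommGroup V] {K : Set Plane}
    (hK : MeasurableSet K) {f : Plane → V} (hf : MemLp f 2 (volume.restrict K)) :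
    ∃ f₀ : Plane → V, StronglyMeasurable f₀ ∧ MemLp f₀ 2 volume ∧ f₀ =ᵐ[volume] K.indicator f := by
  have hm := (hf.aestronglyMeasurable.stronglyMeasurable_mk).indicator hK
  have hae : K.indicator (hf.aestronglyMeasurable.mk f) =ᵐ[volume] K.indicator f := by
    have := (ae_restrict_iff' hK).1 hf.aestronglyMeasurable.ae_eq_mk
    filter_upwards [this] with x hx
    by_cases hxK : x ∈ K
    · rw [indicator_of_mem hxK, indicator_of_mem hxK, hx hxK]
    · rw [indicator_of_notMem hxK, indicator_of_notMem hxK]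
  exact ⟨_, hm, (memLp_congr_ae hae).2 ((memLp_indicator_iff_restrict hK).2 hf), hae⟩

/-- Functions which are smooth on the whole plane are dense in `H¹(K)`, if `K` is star-shaped with
respect to a ball. -/
theorem IsH1WithGradient.exists_contDiff_eLpNorm_sub_le {K : Set Plane} {u : Plane → ℝ}
    {G : Plane → Plane} (hK : IsOpen K) (h : IsH1WithGradient K u G) {c : Plane} {r : ℝ}
    (hr : 0 < r) (hs : ∀ y ∈ Metric.ball c r, StarConvex ℝ y K) {ε : ℝ≥0∞} (hε : ε ≠ 0) :
    ∃ φ : Plane → ℝ, ContDiff ℝ ∞ φ ∧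
      eLpNorm (fun x => φ x - u x) 2 (volume.restrict K) ≤ ε ∧
      eLpNorm (fun x => ∇ φ x - G x) 2 (volume.restrict K) ≤ ε := by
  have hmK := hK.measurableSet
  obtain ⟨u₀, hum, hu2, hu₀⟩ := exists_stronglyMeasurable_indicator hmK h.memLp
  obtain ⟨G₀, hGm, hG2, hG₀⟩ := exists_stronglyMeasurable_indicator hmK h.memLp_grad
  have huK : u₀ =ᵐ[volume.restrict K] u := by
    filter_upwards [ae_restrict_of_ae hu₀, ae_restrict_mem hmK] with x hx hxK
    rw [hx, indicator_of_mem hxK]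
  have hGK : G₀ =ᵐ[volume.restrict K] G := by
    filter_upwards [ae_restrict_of_ae hG₀, ae_restrict_mem hmK] with x hx hxK
    rw [hx, indicator_of_mem hxK]
  have hul : LocallyIntegrable u₀ volume := hu2.locallyIntegrable one_le_two
  have hGl : LocallyIntegrable G₀ volume := hG2.locallyIntegrable one_le_two
  have hε2 : ε / 2 ≠ 0 := ENNReal.div_ne_zero.2 ⟨hε, ENNReal.ofNat_ne_top⟩
  obtain ⟨δ₁, hδ₁, H₁⟩ := hu2.exists_eLpNorm_comp_smul_add_sub_le hε2
  obtain ⟨δ₂, hδ₂, H₂⟩ := hG2.exists_eLpNorm_comp_smul_add_sub_le hε2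
  obtain ⟨δ₃, hδ₃, H₃⟩ : ∃ δ : ℝ, 0 < δ ∧
      ENNReal.ofReal δ * eLpNorm G₀ 2 volume ≤ ε / 2 := by
    have hlim : Tendsto (fun η : ℝ => ENNReal.ofReal η * eLpNorm G₀ 2 volume) (𝓝[>] 0) (𝓝 0) := by
      have h1 : Tendsto (fun η : ℝ => ENNReal.ofReal η) (𝓝[>] 0) (𝓝 0) := by
        simpa using (ENNReal.continuous_ofReal.tendsto 0).mono_left nhdsWithin_le_nhds
      simpa using ENNReal.Tendsto.mul_const h1 (Or.inr hG2.eLpNorm_ne_top)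
    obtain ⟨η, h1, h2⟩ := ((hlim.eventually
      (gt_mem_nhds (pos_iff_ne_zero.2 hε2))).and self_mem_nhdsWithin).exists
    exact ⟨η, h2, h1.le⟩
  -- `1 - t` is called `s`
  obtain ⟨s, hs0, hs1, hsδ₁, hsδ₂, hsδ₃, hsc₁, hsc₂⟩ : ∃ s : ℝ, 0 < s ∧ s < 1 ∧ s < δ₁ ∧ s < δ₂ ∧
      s ≤ δ₃ ∧ s * (‖c‖ + r) < δ₁ ∧ s * (‖c‖ + r) < δ₂ := by
    have hpos : 0 < ‖c‖ + r := by positivity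
    have hev : ∀ {a : ℝ}, 0 < a → ∀ᶠ s : ℝ in 𝓝[>] 0, s < a := fun ha =>
      mem_nhdsWithin_of_mem_nhds (gt_mem_nhds ha)
    have h0 : ∀ᶠ s : ℝ in 𝓝[>] 0, 0 < s := self_mem_nhdsWithin
    obtain ⟨s, h1, h2, h3, h4, h5, h6, h7⟩ := (h0.and ((hev zero_lt_one).and
      ((hev hδ₁).and ((hev hδ₂).and ((hev hδ₃).and ((hev (div_pos hδ₁ hpos)).and
        (hev (div_pos hδ₂ hpos)))))))).exists
    exact ⟨s, h1, h2, h3, h4, h5.le, (lt_div_iff₀ hpos).1 h6, (lt_div_iff₀ hpos).1 h7⟩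
  have hsr : 0 < s * r := by positivity
  -- The outer radius `s r / 2` is smaller than the margin `s r` left by the contraction `x ↦ (1 -
  -- s) x + s c`, so mollifying at an image point only uses values in `K`.
  let ζ : ContDiffBump (0 : Plane) := ⟨s * r / 4, s * r / 2, by positivity, by linarith⟩
  have hζ : ζ.rOut = s * r / 2 := rfl
  have hts : |(1 - s) - 1| = s := by rw [sub_sub_cancel_left, abs_neg, abs_of_pos hs0]
  have hz : ∀ w ∈ Metric.ball (0 : Plane) ζ.rOut, ‖s • c - w‖ ≤ s * (‖c‖ + r) := by
    intro w hw
    rw [mem_ball_zero_iff, hζ] at hw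
    refine (norm_sub_le _ _).trans ?_
    rw [norm_smul, Real.norm_eq_abs, abs_of_pos hs0]
    linarith
  have E₁ : eLpNorm (fun x => mollify ζ u₀ ((1 - s) • x + s • c) - u₀ x) 2 volume ≤ ε / 2 :=
    eLpNorm_mollify_comp_sub_le ζ hum hul fun w hw =>
      H₁ _ _ (by rwa [hts]) ((hz w hw).trans_lt hsc₁)
  have E₂ : eLpNorm (fun x => mollify ζ G₀ ((1 - s) • x + s • c) - G₀ x) 2 volume ≤ ε / 2 :=
    eLpNorm_mollify_comp_sub_le ζ hGm hGl fun w hw =>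
      H₂ _ _ (by rwa [hts]) ((hz w hw).trans_lt hsc₂)
  have hsm : ContDiff ℝ ∞ (mollify ζ u₀) := contDiff_mollify ζ hul
  have hgrad : ∀ x ∈ K, ∇ (fun x => mollify ζ u₀ ((1 - s) • x + s • c)) x =
      (1 - s) • mollify ζ G₀ ((1 - s) • x + s • c) := by
    intro x hx
    rw [gradient_comp_smul_add (hsm.differentiable (by simp)),
      h.gradient_mollify hK hul hGl hu₀ hG₀ ζ]
    intro v hv
    have := lineMap_add_mem_of_starConvex_ball hs hx (v := -v) (t := 1 - s) (by linarith)
      (by linarith) (by rw [norm_neg, sub_sub_cancel]; linarith)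
    convert this using 1
    module
  refine ⟨fun x => mollify ζ u₀ ((1 - s) • x + s • c), hsm.comp (by fun_prop), ?_, ?_⟩
  · calc eLpNorm (fun x => mollify ζ u₀ ((1 - s) • x + s • c) - u x) 2 (volume.restrict K)
        = eLpNorm (fun x => mollify ζ u₀ ((1 - s) • x + s • c) - u₀ x) 2 (volume.restrict K) := by
          refine eLpNorm_congr_ae ?_
          filter_upwards [huK] with x hx
          rw [hx]
      _ ≤ ε / 2 := (eLpNorm_restrict_le _ _ _ _).trans E₁
      _ ≤ ε := ENNReal.half_le_self
  · have hmG : AEStronglyMeasurable (fun x => mollify ζ G₀ ((1 - s) • x + s • c) - G₀ x)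
        volume :=
      (((continuous_mollify ζ hGl).comp (by fun_prop)).aestronglyMeasurable).sub
        hGm.aestronglyMeasurable
    -- The chain rule puts a factor `1 - s` in front of the mollified gradient. The resulting defect
    -- `s • G₀` is what the condition `s ≤ δ₃` controls.
    calc eLpNorm (fun x => ∇ (fun x => mollify ζ u₀ ((1 - s) • x + s • c)) x - G x) 2
          (volume.restrict K)
        = eLpNorm ((fun x => (1 - s) • (mollify ζ G₀ ((1 - s) • x + s • c) - G₀ x)) -
            fun x => s • G₀ x) 2 (volume.restrict K) := by
          refine eLpNorm_congr_ae ?_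
          filter_upwards [hGK, ae_restrict_mem hmK] with x hx hxK
          rw [hgrad x hxK, ← hx]
          simp only [Pi.sub_apply]
          module
      _ ≤ eLpNorm ((fun x => (1 - s) • (mollify ζ G₀ ((1 - s) • x + s • c) - G₀ x)) -
            fun x => s • G₀ x) 2 volume := eLpNorm_restrict_le _ _ _ _
      _ ≤ eLpNorm ((1 - s) • fun x => mollify ζ G₀ ((1 - s) • x + s • c) - G₀ x) 2 volume
            + eLpNorm (s • G₀) 2 volume :=
          eLpNorm_sub_le (hmG.const_smul (1 - s)) (hGm.aestronglyMeasurable.const_smul s) one_le_two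
      _ ≤ ε / 2 + ε / 2 := by
          rw [eLpNorm_const_smul, eLpNorm_const_smul]
          refine add_le_add ?_ ?_
          · refine (mul_le_of_le_one_left' ?_).trans E₂
            rw [Real.enorm_of_nonneg (by linarith), ENNReal.ofReal_le_one]
            linarith
          · refine le_trans ?_ H₃
            rw [Real.enorm_of_nonneg hs0.le]
            gcongr
      _ = ε := ENNReal.add_halves ε

/-! ### The trace inequality in `L²` and existence of traces -/

theorem norm_gradient_eq_norm_fderiv (f : Plane → ℝ) (x : Plane) : ‖∇ f x‖ = ‖fderiv ℝ f x‖ :=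
  LinearIsometryEquiv.norm_map _ _

theorem eLpNorm_gradient_eq (f : Plane → ℝ) (p : ℝ≥0∞) (μ : Measure Plane) :
    eLpNorm (∇ f) p μ = eLpNorm (fderiv ℝ f) p μ :=
  eLpNorm_congr_norm_ae (.of_forall (norm_gradient_eq_norm_fderiv f))

theorem continuous_gradient {f : Plane → ℝ} (hf : ContDiff ℝ 1 f) : Continuous (∇ f) :=
  (LinearIsometryEquiv.continuous _).comp (hf.continuous_fderiv one_ne_zero)

theorem ENNReal.two_mul_mul_le_add_sq (a b : ℝ≥0∞) : 2 * a * b ≤ a ^ 2 + b ^ 2 := by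
  have key : ∀ a d : ℝ≥0∞, 2 * a * (a + d) ≤ a ^ 2 + (a + d) ^ 2 := fun a d => by
    calc 2 * a * (a + d) ≤ 2 * a * (a + d) + d ^ 2 := le_self_add
      _ = _ := by ring
  rcases le_total a b with h | h
  · obtain ⟨d, rfl⟩ := exists_add_of_le h
    exact key a d
  · obtain ⟨d, rfl⟩ := exists_add_of_le h
    calc 2 * (b + d) * b = 2 * b * (b + d) := by ring
      _ ≤ _ := key b d
      _ = _ := add_comm _ _

/-- The trace inequality in `L²` on a polygon which is star-shaped with respect to a ball. -/
theorem IsPolygonalElement.exists_eLpNorm_frontier_le {n : ℕ} {P : Polygon Plane n}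
    {K : Set Plane} (hP : IsPolygonalElement P K) {c : Plane} {r : ℝ} (hr : 0 < r)
    (hB : Metric.ball c r ⊆ K) (hs : ∀ y ∈ Metric.ball c r, StarConvex ℝ y K) :
    ∃ D : ℝ≥0∞, D ≠ ⊤ ∧ ∀ φ : Plane → ℝ, ContDiff ℝ 1 φ →
      eLpNorm φ 2 (arcLength.restrict (frontier K)) ≤
        D * (eLpNorm φ 2 (volume.restrict K) + eLpNorm (∇ φ) 2 (volume.restrict K)) := by
  set H := ENNReal.ofReal (Metric.diam K) with hH
  have hr0 : ENNReal.ofReal r ≠ 0 := by rw [Ne, ENNReal.ofReal_eq_zero, not_le]; exact hr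
  set C := (ENNReal.ofReal r)⁻¹ * (2 + H) with hC
  have hCtop : C ≠ ⊤ := ENNReal.mul_ne_top (ENNReal.inv_ne_top.2 hr0) (by finiteness)
  refine ⟨C + 1, by finiteness, fun φ hφ => ?_⟩
  rw [eLpNorm_gradient_eq]
  set a := eLpNorm φ 2 (volume.restrict K)
  set b := eLpNorm (fderiv ℝ φ) 2 (volume.restrict K)
  -- The derivative of `φ²` is `2 φ dφ`, so the `L¹` inequality for `φ²` is an `L²` inequality for
  -- `φ` after Young's inequality.
  have htr := hP.lintegral_frontier_le hr hB hs (ψ := fun x => φ x ^ 2) (hφ.pow 2)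
  have hfd : ∀ x, ‖fderiv ℝ (fun x => φ x ^ 2) x‖ₑ = 2 * ‖φ x‖ₑ * ‖fderiv ℝ φ x‖ₑ := by
    intro x
    have h1 := ((hφ.differentiable one_ne_zero x).hasFDerivAt.pow 2).fderiv
    rw [h1, enorm_smul]
    simp [enorm_mul, Real.enorm_of_nonneg]
  have h1 : ENNReal.ofReal r * eLpNorm φ 2 (arcLength.restrict (frontier K)) ^ 2 ≤
      (2 + H) * (a + b) ^ 2 := by
    rw [eLpNorm_two_sq]
    calc _ ≤ _ := by simpa only [enorm_pow] using htr
      _ ≤ ∫⁻ x in K, ((2 + H) * ‖φ x‖ₑ ^ 2 + (2 + H) * ‖fderiv ℝ φ x‖ₑ ^ 2) := by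
        refine lintegral_mono fun x => ?_
        simp only
        rw [hfd x, ← hH]
        have h2 : 2 * ‖φ x‖ₑ * ‖fderiv ℝ φ x‖ₑ ≤ ‖φ x‖ₑ ^ 2 + ‖fderiv ℝ φ x‖ₑ ^ 2 :=
          ENNReal.two_mul_mul_le_add_sq _ _
        calc _ ≤ 2 * ‖φ x‖ₑ ^ 2 + H * (‖φ x‖ₑ ^ 2 + ‖fderiv ℝ φ x‖ₑ ^ 2) := by gcongr
          _ ≤ 2 * ‖φ x‖ₑ ^ 2 + H * (‖φ x‖ₑ ^ 2 + ‖fderiv ℝ φ x‖ₑ ^ 2) + 2 * ‖fderiv ℝ φ x‖ₑ ^ 2 :=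
            le_self_add
          _ = _ := by ring
      _ = (2 + H) * (a ^ 2 + b ^ 2) := by
        have hm : Measurable fun x => (2 + H) * ‖φ x‖ₑ ^ 2 :=
          (hφ.continuous.measurable.enorm.pow_const 2).const_mul _
        rw [lintegral_add_left hm, lintegral_const_mul' _ _ (by finiteness),
          lintegral_const_mul' _ _ (by finiteness), eLpNorm_two_sq, eLpNorm_two_sq, mul_add]
      _ ≤ (2 + H) * (a + b) ^ 2 := by
        gcongr
        rw [add_sq]
        calc a ^ 2 + b ^ 2 ≤ a ^ 2 + b ^ 2 + 2 * a * b := le_self_add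
          _ = _ := by ring
  rw [ENNReal.mul_le_iff_le_inv hr0 ENNReal.ofReal_ne_top, ← mul_assoc, ← hC] at h1
  rw [← ENNReal.pow_le_pow_left_iff two_ne_zero, mul_pow]
  refine h1.trans (mul_le_mul_left ?_ _)
  -- Taking `D = C + 1` avoids the square root of `C`, as `C ≤ (C + 1)²`.
  calc C ≤ C + (C ^ 2 + C + 1) := le_self_add
    _ = (C + 1) ^ 2 := by ring

theorem IsPolygonalElement.memLp_of_continuous {n : ℕ} {P : Polygon Plane n} {K : Set Plane}
    (hP : IsPolygonalElement P K) {φ : Plane → ℝ} (hφ : Continuous φ) :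
    MemLp φ 2 (arcLength.restrict (frontier K)) := by
  have hKc : IsCompact (frontier K) :=
    Metric.isCompact_of_isClosed_isBounded isClosed_frontier
      (hP.isBounded.closure.subset frontier_subset_closure)
  have hfin : IsFiniteMeasure (arcLength.restrict (frontier K)) :=
    ⟨by simpa using hP.arcLength_frontier_lt_top⟩
  obtain ⟨M, hM⟩ := hKc.exists_bound_of_continuousOn hφ.continuousOn
  exact MemLp.of_bound hφ.aestronglyMeasurable M
    ((ae_restrict_iff' isClosed_frontier.measurableSet).2 (.of_forall hM))

theorem IsPolygonalElement.exists_isTrace {n : ℕ} {P : Polygon Plane n} {K : Set Plane}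
    (hP : IsPolygonalElement P K) {c : Plane} {r : ℝ} (hr : 0 < r) (hB : Metric.ball c r ⊆ K)
    (hs : ∀ y ∈ Metric.ball c r, StarConvex ℝ y K) {u : Plane → ℝ} {G : Plane → Plane}
    (h : IsH1WithGradient K u G) : ∃ g : Plane → ℝ, IsTrace K u G g := by
  obtain ⟨D, hD, hDle⟩ := hP.exists_eLpNorm_frontier_le hr hB hs
  have hε : ∀ m : ℕ, (2⁻¹ : ℝ≥0∞) ^ m ≠ 0 := fun m => by simp
  have hεtop : ∀ m : ℕ, (2⁻¹ : ℝ≥0∞) ^ m ≠ ⊤ := fun m => ENNReal.pow_ne_top (by simp)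
  have hεle : ∀ {N m : ℕ}, N ≤ m → (2⁻¹ : ℝ≥0∞) ^ m ≤ 2⁻¹ ^ N := fun hNm =>
    pow_le_pow_right_of_le_one' (by simp) hNm
  choose φ hφ hφu hφG using fun m : ℕ => h.exists_contDiff_eLpNorm_sub_le hP.isOpen hr hs (hε m)
  have hφ1 : ∀ m, ContDiff ℝ 1 (φ m) := fun m => (hφ m).of_le (by simp)
  have hdiff : ∀ {V : Type} [NormedAddCommGroup V] {N i j : ℕ} {f : ℕ → Plane → V} {v : Plane → V},
      (∀ m, AEStronglyMeasurable (f m) (volume.restrict K)) →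
      AEStronglyMeasurable v (volume.restrict K) →
      (∀ m, eLpNorm (fun x => f m x - v x) 2 (volume.restrict K) ≤ 2⁻¹ ^ m) → N ≤ i → N ≤ j →
      eLpNorm (fun x => f i x - f j x) 2 (volume.restrict K) ≤ 2⁻¹ ^ N + 2⁻¹ ^ N := by
    intro V _ N i j f v hf hv hfv hi hj
    calc eLpNorm (fun x => f i x - f j x) 2 (volume.restrict K)
        = eLpNorm ((fun x => f i x - v x) - fun x => f j x - v x) 2 (volume.restrict K) := by
          congr 1
          ext1 x
          simp
      _ ≤ 2⁻¹ ^ N + 2⁻¹ ^ N :=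
          (eLpNorm_sub_le ((hf i).sub hv) ((hf j).sub hv) one_le_two).trans
            (add_le_add ((hfv i).trans (hεle hi)) ((hfv j).trans (hεle hj)))
  -- Function and gradient differences are each at most `2 · 2⁻ᴺ`, so the boundary differences are
  -- at most `4 D 2⁻ᴺ`. The extra `1` makes the bound strict, also for `D = 0`.
  have hsum : ∑' m : ℕ, (4 * D + 1) * (2⁻¹ : ℝ≥0∞) ^ m ≠ ⊤ := by
    rw [ENNReal.tsum_mul_left, ENNReal.tsum_geometric, ENNReal.one_sub_inv_two, inv_inv]
    finiteness
  obtain ⟨g, hg, hlim⟩ := Lp.cauchy_complete_eLpNorm (p := 2) one_le_two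
    (fun m => hP.memLp_of_continuous (hφ m).continuous) hsum (by
      intro N i j hi hj
      have hgsub : ∇ (φ i - φ j) = fun x => ∇ (φ i) x - ∇ (φ j) x := by
        ext1 x
        simp only [gradient]
        rw [fderiv_sub ((hφ1 i).differentiable one_ne_zero x)
          ((hφ1 j).differentiable one_ne_zero x), map_sub]
      have h1 := hDle _ ((hφ1 i).sub (hφ1 j))
      have h2 := hdiff (fun m => (hφ m).continuous.aestronglyMeasurable)
        h.memLp.aestronglyMeasurable hφu hi hj
      have h3 := hdiff (fun m => (continuous_gradient (hφ1 m)).aestronglyMeasurable)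
        h.memLp_grad.aestronglyMeasurable hφG hi hj
      rw [← hgsub] at h3
      calc eLpNorm (φ i - φ j) 2 (arcLength.restrict (frontier K))
          ≤ D * ((2⁻¹ ^ N + 2⁻¹ ^ N) + (2⁻¹ ^ N + 2⁻¹ ^ N)) :=
            h1.trans (mul_le_mul_right (add_le_add h2 h3) _)
        _ = 4 * D * 2⁻¹ ^ N := by ring
        _ < (4 * D + 1) * 2⁻¹ ^ N := by
            rw [add_mul, one_mul]
            exact ENNReal.lt_add_right (ENNReal.mul_ne_top (by finiteness) (hεtop N)) (hε N))
  have h0 : Tendsto (fun m : ℕ => (2⁻¹ : ℝ≥0∞) ^ m) atTop (𝓝 0) :=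
    ENNReal.tendsto_pow_atTop_nhds_zero_of_lt_one (by simp)
  exact ⟨g, hg, φ, hφ, tendsto_of_tendsto_of_tendsto_of_le_of_le tendsto_const_nhds h0
    (fun _ => zero_le) hφu, tendsto_of_tendsto_of_tendsto_of_le_of_le tendsto_const_nhds h0
    (fun _ => zero_le) hφG, hlim⟩

/-! ### Passage to the limit and the theorem -/

theorem tendsto_average_of_eLpNorm_two {α : Type*} [MeasurableSpace α] {μ : Measure α}
    [IsFiniteMeasure μ] {f : ℕ → α → ℝ} {g : α → ℝ} (hf : ∀ m, AEStronglyMeasurable (f m) μ)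
    (hg : MemLp g 2 μ) (h : Tendsto (fun m => eLpNorm (fun x => f m x - g x) 2 μ) atTop (𝓝 0)) :
    Tendsto (fun m => ⨍ x, f m x ∂μ) atTop (𝓝 (⨍ x, g x ∂μ)) := by
  simp only [average_eq]
  refine Tendsto.const_smul ?_ _
  have hlim : Tendsto (fun m => eLpNorm (fun x => f m x - g x) 1 μ) atTop (𝓝 0) := by
    have h1 := ENNReal.Tendsto.mul_const
      (b := μ univ ^ (1 / (1 : ℝ≥0∞).toReal - 1 / (2 : ℝ≥0∞).toReal))
      h (Or.inr (ENNReal.rpow_ne_top_of_nonneg (by norm_num) (measure_ne_top μ _)))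
    rw [zero_mul] at h1
    exact tendsto_of_tendsto_of_tendsto_of_le_of_le tendsto_const_nhds h1 (fun _ => zero_le)
      fun m => eLpNorm_le_eLpNorm_mul_rpow_measure_univ one_le_two
        ((hf m).sub hg.aestronglyMeasurable)
  have hint : ∀ᶠ m in atTop, Integrable (f m) μ := by
    filter_upwards [hlim.eventually (gt_mem_nhds ENNReal.zero_lt_top)] with m hm
    have h1 : MemLp (fun x => f m x - g x) 1 μ := ⟨(hf m).sub hg.aestronglyMeasurable, hm⟩
    have h2 := (memLp_one_iff_integrable.1 h1).add (hg.integrable one_le_two)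
    refine h2.congr (.of_forall fun x => ?_)
    simp
  refine tendsto_integral_of_L1 g hg.aestronglyMeasurable hint ?_
  simpa only [eLpNorm_one_eq_lintegral_enorm] using hlim

/-- The smooth estimate passes to the limit along the sequence that witnesses the trace property of
`g` itself, so uniqueness of traces is not needed. -/
theorem IsTrace.enorm_average_sub_average_le {γ₀ γ₁ : ℝ} (h₀ : 0 < γ₀) (h₁ : 0 < γ₁)
    {n : ℕ} {P : Polygon Plane n} {K : Set Plane} (hP : IsPolygonalElement P K)
    (hreg : IsShapeRegular γ₀ γ₁ P K) {τ : Set Plane} (hτ : τ ⊆ frontier K)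
    (hτl : γ₁ * Metric.diam K ≤ arcLength.real τ) {u : Plane → ℝ} {G : Plane → Plane}
    (h : IsH1WithGradient K u G) {g : Plane → ℝ} (hg : IsTrace K u G g) :
    ‖(⨍ x in τ, g x ∂arcLength) - ⨍ x in K, u x‖ₑ ≤
      ENNReal.ofReal (averageConst γ₀ γ₁) * eLpNorm G 2 (volume.restrict K) := by
  obtain ⟨hg2, φ, hφ, hφu, hφG, hφg⟩ := hg
  have hφ1 : ∀ m, ContDiff ℝ 1 (φ m) := fun m => (hφ m).of_le (by simp)
  have hle : arcLength.restrict τ ≤ arcLength.restrict (frontier K) :=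
    Measure.restrict_mono hτ le_rfl
  have hfinK : IsFiniteMeasure (volume.restrict K) :=
    ⟨by simpa using hP.isBounded.measure_lt_top⟩
  have hfinτ : IsFiniteMeasure (arcLength.restrict τ) :=
    ⟨by simpa using (measure_mono hτ).trans_lt hP.arcLength_frontier_lt_top⟩
  have l1 := tendsto_average_of_eLpNorm_two (μ := arcLength.restrict τ)
    (fun m => (hφ m).continuous.aestronglyMeasurable) (hg2.mono_measure hle)
    (tendsto_of_tendsto_of_tendsto_of_le_of_le tendsto_const_nhds hφg (fun _ => zero_le)
      fun m => eLpNorm_mono_measure _ hle)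
  have l2 := tendsto_average_of_eLpNorm_two (μ := volume.restrict K)
    (fun m => (hφ m).continuous.aestronglyMeasurable) h.memLp hφu
  have l3 : Tendsto (fun m => ENNReal.ofReal (averageConst γ₀ γ₁) *
      (eLpNorm (fun x => ∇ (φ m) x - G x) 2 (volume.restrict K) +
        eLpNorm G 2 (volume.restrict K))) atTop
      (𝓝 (ENNReal.ofReal (averageConst γ₀ γ₁) * (0 + eLpNorm G 2 (volume.restrict K)))) :=
    ENNReal.Tendsto.const_mul (hφG.add_const _) (Or.inr ENNReal.ofReal_ne_top)
  rw [zero_add] at l3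
  refine le_of_tendsto_of_tendsto' (l1.sub l2).enorm l3 fun m => ?_
  refine (hP.enorm_average_sub_average_le h₀ h₁ hreg hτ hτl (hφ1 m)).trans ?_
  rw [← eLpNorm_gradient_eq]
  refine mul_le_mul_right ?_ _
  have hadd := eLpNorm_add_le (μ := volume.restrict K) (p := 2)
    ((continuous_gradient (hφ1 m)).aestronglyMeasurable.sub h.memLp_grad.aestronglyMeasurable)
    h.memLp_grad.aestronglyMeasurable one_le_two
  rwa [sub_add_cancel] at hadd

theorem IsTrace.sq_average_sub_average_le {γ₀ γ₁ : ℝ} (h₀ : 0 < γ₀) (h₁ : 0 < γ₁)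
    {n : ℕ} {P : Polygon Plane n} {K : Set Plane} (hP : IsPolygonalElement P K)
    (hreg : IsShapeRegular γ₀ γ₁ P K) {τ : Set Plane} (hτ : τ ⊆ frontier K)
    (hτl : γ₁ * Metric.diam K ≤ arcLength.real τ) {u : Plane → ℝ} {G : Plane → Plane}
    (h : IsH1WithGradient K u G) {g : Plane → ℝ} (hg : IsTrace K u G g) :
    ((⨍ x in τ, g x ∂arcLength) - ⨍ x in K, u x) ^ 2 ≤
      averageConst γ₀ γ₁ ^ 2 * h1SeminormSq K G := by
  have hc := averageConst_nonneg h₀ h₁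
  have h1 := pow_le_pow_left' (hg.enorm_average_sub_average_le h₀ h₁ hP hreg hτ hτl h) 2
  have hS : eLpNorm G 2 (volume.restrict K) ^ 2 = ENNReal.ofReal (h1SeminormSq K G) := by
    rw [eLpNorm_two_sq, h1SeminormSq, ofReal_integral_eq_lintegral_ofReal
      (h.memLp_grad.integrable_norm_pow two_ne_zero) (.of_forall fun x => by positivity)]
    refine lintegral_congr fun x => ?_
    rw [← ofReal_norm, ENNReal.ofReal_pow (norm_nonneg _)]
  have hS0 : 0 ≤ h1SeminormSq K G := integral_nonneg fun x => by positivity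
  rw [mul_pow, hS, ← ofReal_norm, ← ENNReal.ofReal_pow (norm_nonneg _), ← ENNReal.ofReal_pow hc,
    ← ENNReal.ofReal_mul (by positivity), ENNReal.ofReal_le_ofReal_iff (by positivity),
    Real.norm_eq_abs, sq_abs] at h1
  exact h1

end

theorem mainTheorem9 (γ₀ γ₁ : ℝ) (hγ₀ : 0 < γ₀) (hγ₁ : 0 < γ₁) :
    ∃ C : ℝ, 0 < C ∧
      ∀ (n : ℕ) (P : Polygon Plane n) (K : Set Plane),
        IsPolygonalElement P K → IsShapeRegular γ₀ γ₁ P K →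
      ∀ τ : Set Plane, τ ⊆ frontier K → IsConnected τ →
        γ₁ * Metric.diam K ≤ arcLength.real τ →
      ∀ (u : Plane → ℝ) (G : Plane → Plane), IsH1WithGradient K u G →
        (∃ g : Plane → ℝ, IsTrace K u G g) ∧
        ∀ g : Plane → ℝ, IsTrace K u G g →
          h1NormSq K u G ≤ C * (|⨍ x in τ, g x ∂arcLength| ^ 2 + h1SeminormSq K G) ∧
          |⨍ x in τ, g x ∂arcLength| ^ 2 + h1SeminormSq K G ≤ C * h1NormSq K u G := by
  refine ⟨2 + 2 * averageConst γ₀ γ₁ ^ 2, by positivity, ?_⟩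
  intro n P K hP hreg τ hτ _ hτl u G h
  obtain ⟨c, r, hrγ, hB, hs⟩ := hreg.starShaped
  have hr : 0 < r := lt_of_lt_of_le (mul_pos hγ₀ hP.diam_pos) hrγ
  refine ⟨hP.exists_isTrace hr hB hs h, fun g hg => ?_⟩
  have key := hg.sq_average_sub_average_le hγ₀ hγ₁ hP hreg hτ hτl h
  have hS0 : 0 ≤ h1SeminormSq K G := integral_nonneg fun x => by positivity
  rw [h1NormSq, sq_abs, sq_abs]
  set x := ⨍ x in τ, g x ∂arcLength
  set y := ⨍ x in K, u x
  set S := h1SeminormSq K G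
  set a := averageConst γ₀ γ₁
  have hxa : 0 ≤ a ^ 2 * x ^ 2 := by positivity
  have hya : 0 ≤ a ^ 2 * y ^ 2 := by positivity
  constructor
  -- `2x² + 2(x - y)² - y² = (2x - y)²`; the other inequality is the same with `x` and `y`
  -- exchanged.
  · nlinarith [sq_nonneg (2 * x - y)]
  · nlinarith [sq_nonneg (2 * y - x)]
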